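/- Let $\Gamma$ and $\Lambda$ be countable, locally finite groups (every finitely generated subgroup is finite), equipped with proper left-invariant metrics $d_\Gamma$ and $d_\Lambda$ respectively. For a metric space $X$ with bounded geometry and $p\in[1,\infty)$, let $B^p_u(X)$ denote the $\ell^p$ uniform Roe algebra of $X$: the operator norm closure of the algebra of all bounded operators $T$ on the complex Banach space $\ell^p(X)$ whose propagation $\sup\{d(x,y) : x,y\in X,\ (T\delta_y)(x)\neq 0\}$ is finite. Let $K_0(A)$ denote the algebraic $K_0$ group of a unital algebra $A$, i.e. the Grothendieck group of the monoid of idempotent square matrices over $A$ modulo algebraic equivalence ($e\sim f$ if $e=xy$ and $f=yx$ for some matrices $x,y$ over $A$), with addition given by block diagonal sums. Metric spaces $X$ and $Y$ are coarsely equivalent if there are maps $f:X\to Y$ and $g:Y\to X$, each sending pairs of points at uniformly bounded distance to pairs of points at uniformly bounded distance, such that $f\circ g$ and $g\circ f$ are at bounded distance from the respective identity maps. Then the following conditions are equivalent: 1. $(\Gamma,d_\Gamma)$ and $(\Lambda,d_\Lambda)$ are coarsely equivalent. 2. $K_0(B^p_u(\Gamma))\cong K_0(B^p_u(\Lambda))$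 as abelian groups for all $p\in[1,\infty)$. 3. $K_0(B^p_u(\Gamma))\cong K_0(B^p_u(\Lambda))$ as abelian groups for some $p\in[1,\infty)$. -/

import Mathlib

open scoped ENNReal

/-! ### Coarse geometry -/

/-- A map is uniformly expansive if it sends pairs of points at bounded distance to pairs of
points at bounded distance, uniformly. -/
def UniformlyExpansive {X Y : Type*} [MetricSpace X] [MetricSpace Y] (f : X → Y) : Prop :=
  ∀ R : ℝ, 0 < R → ∃ S : ℝ, 0 < S ∧ ∀ x₁ x₂ : X, dist x₁ x₂ ≤ R → dist (f x₁) (f x₂) ≤ S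

/-- Two maps are close if they are at bounded distance from each other. -/
def CloseMaps {X Y : Type*} [MetricSpace Y] (f g : X → Y) : Prop :=
  ∃ C : ℝ, 0 < C ∧ ∀ x : X, dist (f x) (g x) ≤ C

/-- Coarse equivalence of metric spaces. -/
def CoarselyEquivalent (X Y : Type*) [MetricSpace X] [MetricSpace Y] : Prop :=
  ∃ (f : X → Y) (g : Y → X), UniformlyExpansive f ∧ UniformlyExpansive g ∧
    CloseMaps (f ∘ g) id ∧ CloseMaps (g ∘ f) id

/-- A group is locally finite if all its finitely generated subgroups are finite. -/
def IsLocallyFiniteGroup (G : Type*) [Group G] : Prop :=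
  ∀ H : Subgroup G, H.FG → Finite H

/-! ### The `ℓ^p` uniform Roe algebra -/

section Roe

variable {X : Type*} {p : ℝ≥0∞} [Fact (1 ≤ p)]

/-- The complex Banach space `ℓ^p(X)`. -/
abbrev EllP (X : Type*) (p : ℝ≥0∞) : Type _ := lp (fun _ : X => ℂ) p

open Classical in
/-- The matrix entry `T_{xy} = (T δ_y)(x)` of a bounded operator on `ℓ^p(X)`. -/
noncomputable def opEntry (T : EllP X p →L[ℂ] EllP X p) (x y : X) : ℂ :=
  T (lp.single p y (1 : ℂ)) x

/-- The propagation of a bounded operator, the supremum in `[0, ∞]` of the distances `d(x, y)`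
over all `x, y` with `T_{xy} ≠ 0`. -/
noncomputable def propagation [MetricSpace X] (T : EllP X p →L[ℂ] EllP X p) : ℝ≥0∞ :=
  ⨆ (x : X) (y : X) (_ : opEntry T x y ≠ 0), edist x y

theorem edist_le_propagation [MetricSpace X] (T : EllP X p →L[ℂ] EllP X p) {x y : X}
    (h : opEntry T x y ≠ 0) : edist x y ≤ propagation T :=
  le_iSup_of_le x (le_iSup_of_le y (le_iSup_of_le h le_rfl))

theorem propagation_le [MetricSpace X] (T : EllP X p →L[ℂ] EllP X p) {r : ℝ≥0∞}
    (h : ∀ x y, opEntry T x y ≠ 0 → edist x y ≤ r) : propagation T ≤ r :=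
  iSup_le fun x => iSup_le fun y => iSup_le fun hxy => h x y hxy

theorem opEntry_add (S T : EllP X p →L[ℂ] EllP X p) (x y : X) :
    opEntry (S + T) x y = opEntry S x y + opEntry T x y := rfl

open Classical in
theorem opEntry_algebraMap (c : ℂ) {x y : X} (h : x ≠ y) :
    opEntry (algebraMap ℂ (EllP X p →L[ℂ] EllP X p) c) x y = 0 := by
  simp [opEntry, Algebra.algebraMap_eq_smul_one, Pi.single_eq_of_ne h]

/-- A nonzero entry of a product comes from a pair of nonzero entries of the factors. -/
theorem exists_opEntry_mul (hp : p ≠ ⊤) (S T : EllP X p →L[ℂ] EllP X p) {x y : X}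
    (h : opEntry (S * T) x y ≠ 0) : ∃ z, opEntry S x z ≠ 0 ∧ opEntry T z y ≠ 0 := by
  classical
  by_contra! hz
  apply h
  set f : EllP X p := T (lp.single p y (1 : ℂ)) with hf
  have hs := (lp.hasSum_single hp f).mapL ((lp.evalCLM ℂ (fun _ : X => ℂ) p x).comp S)
  have h0 : ∀ i, ((lp.evalCLM ℂ (fun _ : X => ℂ) p x).comp S) (lp.single p i (f i)) = 0 := by
    intro i
    have e : lp.single p i (f i) = f i • lp.single (E := fun _ : X => ℂ) p i (1 : ℂ) := by
      rw [← lp.single_smul]; simp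
    by_cases hi : opEntry S x i = 0
    · rw [e, map_smul]
      have : ((lp.evalCLM ℂ (fun _ : X => ℂ) p x).comp S)
        (lp.single (E := fun _ : X => ℂ) p i (1 : ℂ)) = 0 := by
        simp only [opEntry] at hi
        change (S (lp.single p i (1 : ℂ))) x = 0
        convert hi
      rw [this, smul_zero]
    · have : f i = 0 := by
        have := hz i hi
        simp only [opEntry] at this
        rw [hf]
        convert this
      rw [this]; simp
  simp only [h0] at hs
  have := hs.unique hasSum_zero
  change (S (T (lp.single p y (1 : ℂ)))) x = 0 at this
  simp only [opEntry]
  change (S (T (lp.single p y (1 : ℂ)))) x = 0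
  convert this

/-- The algebra of all bounded operators on `ℓ^p(X)` with finite propagation, `p < ∞`. -/
noncomputable def finitePropagationAlgebra (X : Type*) [MetricSpace X] (p : ℝ≥0∞)
    [Fact (1 ≤ p)] (hp : p ≠ ⊤) : Subalgebra ℂ (EllP X p →L[ℂ] EllP X p) where
  carrier := {T | propagation T < ⊤}
  mul_mem' {S T} hS hT := by
    refine lt_of_le_of_lt (propagation_le _ fun x y h => ?_) (ENNReal.add_lt_top.2 ⟨hS, hT⟩)
    obtain ⟨z, h1, h2⟩ := exists_opEntry_mul hp S T h
    exact (edist_triangle x z y).trans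
      (add_le_add (edist_le_propagation S h1) (edist_le_propagation T h2))
  add_mem' {S T} hS hT := by
    refine lt_of_le_of_lt (propagation_le _ fun x y h => ?_) (max_lt hS hT)
    rw [opEntry_add] at h
    by_cases hSx : opEntry S x y = 0
    · refine (edist_le_propagation T fun hTx => h ?_).trans (le_max_right _ _)
      rw [hSx, hTx, add_zero]
    · exact (edist_le_propagation S hSx).trans (le_max_left _ _)
  algebraMap_mem' c := by
    refine lt_of_le_of_lt (propagation_le (r := 0) _ fun x y h => ?_) ENNReal.zero_lt_top
    by_cases hxy : x = y
    · simp [hxy]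
    · exact absurd (opEntry_algebraMap c hxy) h

/-- The `ℓ^p` uniform Roe algebra `B^p_u(X)`: the operator norm closure of the algebra of bounded
operators on `ℓ^p(X)` with finite propagation. -/
noncomputable def uniformRoeAlgebra (X : Type*) [MetricSpace X] (p : ℝ≥0∞)
    [Fact (1 ≤ p)] (hp : p ≠ ⊤) : Subalgebra ℂ (EllP X p →L[ℂ] EllP X p) :=
  (finitePropagationAlgebra X p hp).topologicalClosure

end Roe

/-! ### The group `K_0` of a unital ring -/

section KZero

variable {A : Type*} [Ring A]

/-- Algebraic (Murray-von Neumann) equivalence of square matrices of possibly different sizes. -/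
def MatEquiv {ι κ : Type*} [Fintype ι] [Fintype κ] (e : Matrix ι ι A) (f : Matrix κ κ A) : Prop :=
  ∃ (x : Matrix ι κ A) (y : Matrix κ ι A), e = x * y ∧ f = y * x

section

variable {ι κ μ ν : Type*} [Fintype ι] [Fintype κ] [Fintype μ] [Fintype ν]

theorem MatEquiv.symm {e : Matrix ι ι A} {f : Matrix κ κ A} (h : MatEquiv e f) :
    MatEquiv f e := by
  obtain ⟨x, y, h1, h2⟩ := h
  exact ⟨y, x, h2, h1⟩

theorem MatEquiv.trans {e : Matrix ι ι A} {f : Matrix κ κ A} {g : Matrix μ μ A}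
    (he : IsIdempotentElem e) (hg : IsIdempotentElem g)
    (h : MatEquiv e f) (h' : MatEquiv f g) : MatEquiv e g := by
  obtain ⟨x, y, h1, h2⟩ := h
  obtain ⟨z, w, h3, h4⟩ := h'
  refine ⟨x * z, w * y, ?_, ?_⟩
  · calc e = (x * y) * (x * y) := by rw [← h1, he.eq]
      _ = x * (y * x) * y := by simp only [Matrix.mul_assoc]
      _ = x * (z * w) * y := by rw [← h2, h3]
      _ = (x * z) * (w * y) := by simp only [Matrix.mul_assoc]
  · calc g = (w * z) * (w * z) := by rw [← h4, hg.eq]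
      _ = w * (z * w) * z := by simp only [Matrix.mul_assoc]
      _ = w * (y * x) * z := by rw [← h3, h2]
      _ = (w * y) * (x * z) := by simp only [Matrix.mul_assoc]

theorem isIdempotentElem_submatrix {e : Matrix ι ι A} (he : IsIdempotentElem e) (s : κ ≃ ι) :
    IsIdempotentElem (e.submatrix s s) := by
  rw [IsIdempotentElem, Matrix.submatrix_mul_equiv, he.eq]

theorem matEquiv_submatrix {e : Matrix ι ι A} (he : IsIdempotentElem e) (s : κ ≃ ι) :
    MatEquiv e (e.submatrix s s) := by
  refine ⟨e.submatrix id s, e.submatrix s id, ?_, ?_⟩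
  · rw [Matrix.submatrix_mul_equiv, he.eq, Matrix.submatrix_id_id]
  · have := Matrix.submatrix_mul_equiv e e s (Equiv.refl ι) s
    rw [he.eq] at this
    exact this.symm

theorem isIdempotentElem_fromBlocks {e : Matrix ι ι A} {f : Matrix κ κ A}
    (he : IsIdempotentElem e) (hf : IsIdempotentElem f) :
    IsIdempotentElem (Matrix.fromBlocks e 0 0 f) := by
  rw [IsIdempotentElem, Matrix.fromBlocks_multiply]
  simp [he.eq, hf.eq]

theorem MatEquiv.fromBlocks {e : Matrix ι ι A} {f : Matrix κ κ A} {e' : Matrix μ μ A}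
    {f' : Matrix ν ν A} (h : MatEquiv e e') (h' : MatEquiv f f') :
    MatEquiv (Matrix.fromBlocks e 0 0 f) (Matrix.fromBlocks e' 0 0 f') := by
  obtain ⟨x, y, h1, h2⟩ := h
  obtain ⟨z, w, h3, h4⟩ := h'
  refine ⟨Matrix.fromBlocks x 0 0 z, Matrix.fromBlocks y 0 0 w, ?_, ?_⟩ <;>
    rw [Matrix.fromBlocks_multiply] <;> simp [h1, h2, h3, h4]

end

variable (A) in
/-- An idempotent square matrix over `A`, of some size `n`. -/
structure IdemMat where
  size : ℕ
  mat : Matrix (Fin size) (Fin size) A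
  idem : IsIdempotentElem mat

namespace IdemMat

/-- Idempotent matrices modulo algebraic equivalence. -/
instance setoid (A : Type*) [Ring A] : Setoid (IdemMat A) where
  r e f := MatEquiv e.mat f.mat
  iseqv :=
    { refl := fun e => ⟨e.mat, e.mat, e.idem.eq.symm, e.idem.eq.symm⟩
      symm := MatEquiv.symm
      trans := fun {e _ g} h h' => MatEquiv.trans e.idem g.idem h h' }

/-- The `n × n` idempotent matrix obtained from one indexed by another type with `n` elements. -/
def ofEquiv {ι : Type*} [Fintype ι] {n : ℕ} (s : Fin n ≃ ι) (e : Matrix ι ι A)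
    (he : IsIdempotentElem e) : IdemMat A :=
  ⟨n, e.submatrix s s, isIdempotentElem_submatrix he s⟩

theorem ofEquiv_equiv_ofEquiv {ι κ : Type*} [Fintype ι] [Fintype κ] {m n : ℕ} (s : Fin m ≃ ι)
    (t : Fin n ≃ κ) {e : Matrix ι ι A} {f : Matrix κ κ A} (he : IsIdempotentElem e)
    (hf : IsIdempotentElem f) (h : MatEquiv e f) : ofEquiv s e he ≈ ofEquiv t f hf :=
  MatEquiv.trans (isIdempotentElem_submatrix he s) (isIdempotentElem_submatrix hf t)
    (matEquiv_submatrix he s).symm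
    (MatEquiv.trans he (isIdempotentElem_submatrix hf t) h (matEquiv_submatrix hf t))

/-- The block diagonal sum `e ⊕ f = diag(e, f)`. -/
def directSum (e f : IdemMat A) : IdemMat A :=
  ofEquiv finSumFinEquiv.symm (Matrix.fromBlocks e.mat 0 0 f.mat)
    (isIdempotentElem_fromBlocks e.idem f.idem)

/-- The empty matrix. -/
def empty (A : Type*) [Ring A] : IdemMat A :=
  ⟨0, 0, by rw [IsIdempotentElem, mul_zero]⟩

theorem matEquiv_directSum (e f : IdemMat A) :
    MatEquiv (Matrix.fromBlocks e.mat 0 0 f.mat) (directSum e f).mat :=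
  matEquiv_submatrix (isIdempotentElem_fromBlocks e.idem f.idem) _

theorem directSum_congr {e e' f f' : IdemMat A} (h : e ≈ e') (h' : f ≈ f') :
    directSum e f ≈ directSum e' f' :=
  ofEquiv_equiv_ofEquiv _ _ _ _ (MatEquiv.fromBlocks h h')

theorem directSum_comm (e f : IdemMat A) : directSum e f ≈ directSum f e := by
  refine ofEquiv_equiv_ofEquiv _ _ _ _ ?_
  have := matEquiv_submatrix (isIdempotentElem_fromBlocks e.idem f.idem)
    (Equiv.sumComm (Fin f.size) (Fin e.size))
  simpa using this

theorem directSum_empty (e : IdemMat A) : directSum e (empty A) ≈ e := by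
  refine MatEquiv.trans (directSum e (empty A)).idem e.idem
    (matEquiv_directSum e (empty A)).symm ?_
  refine ⟨Matrix.fromRows e.mat 0, Matrix.fromCols e.mat 0, ?_, ?_⟩
  · rw [Matrix.fromRows_mul_fromCols, e.idem.eq]
    rw [Matrix.mul_zero, Matrix.zero_mul, Matrix.mul_zero]
    rfl
  · rw [Matrix.fromCols_mul_fromRows, e.idem.eq]
    simp

theorem directSum_assoc (e f g : IdemMat A) :
    directSum (directSum e f) g ≈ directSum e (directSum f g) := by
  have hl := isIdempotentElem_fromBlocks (isIdempotentElem_fromBlocks e.idem f.idem) g.idem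
  have hr := isIdempotentElem_fromBlocks e.idem (isIdempotentElem_fromBlocks f.idem g.idem)
  have hg : MatEquiv g.mat g.mat := Setoid.refl g
  have he : MatEquiv e.mat e.mat := Setoid.refl e
  refine ofEquiv_equiv_ofEquiv _ _ _ _ ?_
  refine MatEquiv.trans (isIdempotentElem_fromBlocks (directSum e f).idem g.idem)
    (isIdempotentElem_fromBlocks e.idem (directSum f g).idem)
    (MatEquiv.fromBlocks (matEquiv_directSum e f).symm hg) ?_
  refine MatEquiv.trans hl (isIdempotentElem_fromBlocks e.idem (directSum f g).idem) ?_
    (MatEquiv.fromBlocks he (matEquiv_directSum f g))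
  have := matEquiv_submatrix hl (Equiv.sumAssoc (Fin e.size) (Fin f.size) (Fin g.size)).symm
  convert this using 1
  ext (i | i | i) (j | j | j) <;> simp

end IdemMat

/-- The monoid `V(A)` of equivalence classes of idempotent matrices over `A`. -/
def IdemClasses (A : Type*) [Ring A] : Type _ := Quotient (IdemMat.setoid A)

/-- The addition on `V(A)` is `[e] + [f] = [diag(e, f)]`. -/
instance IdemClasses.instAdd (A : Type*) [Ring A] : Add (IdemClasses A) where
  add := Quotient.map₂ IdemMat.directSum
    fun _ _ h _ _ h' => IdemMat.directSum_congr h h'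

instance IdemClasses.instZero (A : Type*) [Ring A] : Zero (IdemClasses A) where
  zero := Quotient.mk _ (IdemMat.empty A)

instance IdemClasses.instAddCommMonoid (A : Type*) [Ring A] : AddCommMonoid (IdemClasses A) where
  add_assoc a b c := by
    induction a using Quotient.inductionOn
    induction b using Quotient.inductionOn
    induction c using Quotient.inductionOn
    exact Quotient.sound (IdemMat.directSum_assoc _ _ _)
  add_comm a b := by
    induction a using Quotient.inductionOn
    induction b using Quotient.inductionOn
    exact Quotient.sound (IdemMat.directSum_comm _ _)
  add_zero a := by
    induction a using Quotient.inductionOn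
    exact Quotient.sound (IdemMat.directSum_empty _)
  zero_add a := by
    induction a using Quotient.inductionOn
    exact Quotient.sound (Setoid.trans (IdemMat.directSum_comm _ _) (IdemMat.directSum_empty _))
  nsmul := nsmulRec

/-- The abelian group `K_0(A)` of a unital ring: the Grothendieck group of `V(A)`. -/
abbrev KZero (A : Type*) [Ring A] : Type _ := Algebra.GrothendieckAddGroup (IdemClasses A)

end KZero

/-! Coarse invariance. A coarse equivalence between spaces of bounded geometry has finite fibres of
uniformly bounded size, so its domain splits into finitely many pieces on each of which it is
injective. Partial translations along these pieces turn an operator on one space into a matrix of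
operators on the other (`coarseHom`). The two homomorphisms so obtained, one for each direction,
compose to a conjugation by partial translations of bounded displacement. These lie in the Roe
algebra, so the composites act trivially on classes of idempotents.

The converse needs `K_0` only to separate finite groups from infinite ones: two finite groups are
trivially coarsely equivalent, and so are any two infinite countable locally finite groups
(`coarselyEquivalent_of_infinite`). For a finite group, coarse invariance reduces to a point, where
the algebra is `ℂ` and `K_0` is cyclic. For an infinite group `G`, exhausted by finite subgroups `H
n`, an operator of finite propagation preserves the cosets of `H n` for large `n`. Averaging
diagonal entries over `H n` is therefore asymptotically tracial, and the quotient by null sequences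
gives a trace without any choice of limit. The projection onto a transversal of `H k` has trace `1 /
|H k|`. Arbitrarily large denominators cannot occur if `K_0` is cyclic
(`not_exists_forall_kZero_eq_zsmul`).

For two infinite groups, chains `H k` and `K k` are chosen alternately, with integers `s k`, so that
`s k` or `s k + 1` cosets of `H k` can be mapped onto one coset of `K k` compatibly with all lower
levels. The slack of one makes divisibility conditions unnecessary: large enough indices can always
be distributed this way (`exists_admissible`, `exists_refinement`). A limit along an ultrafilter
gives a surjection of the whole groups, and any section of it is a coarse inverse. -/

/-! ### Functoriality of `K_0` -/

section KZeroFunctoriality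

variable {A B : Type*} [Ring A] [Ring B]

namespace IdemClasses

/-- The class in `V(A)` of an idempotent matrix. -/
def mk (e : IdemMat A) : IdemClasses A := Quotient.mk _ e

theorem exists_eq_mk (c : IdemClasses A) : ∃ e : IdemMat A, c = mk e := by
  induction c using Quotient.inductionOn with
  | h e => exact ⟨e, rfl⟩

/-- The class in `V(A)` of an idempotent matrix indexed by an arbitrary finite type. -/
noncomputable def cls {ι : Type*} [Fintype ι] (e : Matrix ι ι A) (he : IsIdempotentElem e) :
    IdemClasses A :=
  Quotient.mk _ (IdemMat.ofEquiv (Fintype.equivFin ι).symm e he)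

theorem cls_eq {ι κ : Type*} [Fintype ι] [Fintype κ] {e : Matrix ι ι A} {f : Matrix κ κ A}
    (he : IsIdempotentElem e) (hf : IsIdempotentElem f) (h : MatEquiv e f) :
    cls e he = cls f hf :=
  Quotient.sound (IdemMat.ofEquiv_equiv_ofEquiv _ _ he hf h)

theorem mk_eq_cls (e : IdemMat A) : mk e = cls e.mat e.idem :=
  Quotient.sound (matEquiv_submatrix e.idem _)

theorem exists_eq_cls (c : IdemClasses A) : ∃ (n : ℕ) (e : Matrix (Fin n) (Fin n) A)
    (he : IsIdempotentElem e), c = cls e he := by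
  obtain ⟨e, rfl⟩ := exists_eq_mk c
  exact ⟨e.size, e.mat, e.idem, mk_eq_cls e⟩

theorem mk_add_mk (e f : IdemMat A) :
    mk e + mk f = mk (IdemMat.directSum e f) :=
  rfl

theorem cls_fromBlocks {ι κ : Type*} [Fintype ι] [Fintype κ] {e : Matrix ι ι A}
    {f : Matrix κ κ A} (he : IsIdempotentElem e) (hf : IsIdempotentElem f) :
    cls (Matrix.fromBlocks e 0 0 f) (isIdempotentElem_fromBlocks he hf) = cls e he + cls f hf := by
  refine Quotient.sound (MatEquiv.trans (isIdempotentElem_submatrix (isIdempotentElem_fromBlocks he hf) _)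
    (IdemMat.directSum _ _).idem (matEquiv_submatrix
      (isIdempotentElem_fromBlocks he hf) _).symm
    (MatEquiv.trans (isIdempotentElem_fromBlocks he hf) (IdemMat.directSum _ _).idem ?_
      (IdemMat.matEquiv_directSum _ _)))
  exact MatEquiv.fromBlocks (matEquiv_submatrix he _) (matEquiv_submatrix hf _)

theorem cls_of_isEmpty {ι : Type*} [Fintype ι] [IsEmpty ι] {e : Matrix ι ι A}
    (he : IsIdempotentElem e) : cls e he = 0 := by
  have h0 : (0 : IdemClasses A) = cls (IdemMat.empty A).mat (IdemMat.empty A).idem :=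
    mk_eq_cls (IdemMat.empty A)
  rw [h0]
  refine cls_eq _ _ ⟨0, 0, ?_, ?_⟩
  · ext i
    exact isEmptyElim i
  · ext i
    exact Fin.elim0 i

end IdemClasses

/-! ### Maps on `V` induced by homomorphisms into matrices; Morita equivalence. -/

section Block

variable {ι κ l m n : Type*} [Fintype ι]

/-- The entrywise application of a homomorphism from `A` to matrices over `B`, as a matrix
over `B`. -/
def blockMap (Φ : A →ₙ+* Matrix ι ι B) (M : Matrix m n A) : Matrix (m × ι) (n × ι) B :=
  Matrix.of fun a b => Φ (M a.1 b.1) a.2 b.2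

theorem blockMap_apply (Φ : A →ₙ+* Matrix ι ι B) (M : Matrix m n A) (a b) :
    blockMap Φ M a b = Φ (M a.1 b.1) a.2 b.2 := rfl

theorem blockMap_mul [Fintype m] (Φ : A →ₙ+* Matrix ι ι B) (M : Matrix l m A) (N : Matrix m n A) :
    blockMap Φ (M * N) = blockMap Φ M * blockMap Φ N := by
  ext a b
  simp only [blockMap_apply, Matrix.mul_apply, map_sum, map_mul, Matrix.sum_apply,
    Fintype.sum_prod_type]

theorem isIdempotentElem_blockMap [Fintype n] (Φ : A →ₙ+* Matrix ι ι B) {e : Matrix n n A}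
    (he : IsIdempotentElem e) : IsIdempotentElem (blockMap Φ e) := by
  rw [IsIdempotentElem, ← blockMap_mul, he.eq]

variable [Fintype m] [Fintype n]

theorem MatEquiv.blockMap (Φ : A →ₙ+* Matrix ι ι B) {e : Matrix m m A} {f : Matrix n n A}
    (h : MatEquiv e f) : MatEquiv (blockMap Φ e) (blockMap Φ f) := by
  obtain ⟨x, y, rfl, rfl⟩ := h
  exact ⟨_root_.blockMap Φ x, _root_.blockMap Φ y, blockMap_mul .., blockMap_mul ..⟩

namespace IdemClasses

theorem cls_blockMap_add (Φ : A →ₙ+* Matrix ι ι B) {e : Matrix m m A} {f : Matrix n n A}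
    (he : IsIdempotentElem e) (hf : IsIdempotentElem f) :
    cls (blockMap Φ (Matrix.fromBlocks e 0 0 f))
        (isIdempotentElem_blockMap Φ (isIdempotentElem_fromBlocks he hf)) =
      cls (blockMap Φ e) (isIdempotentElem_blockMap Φ he) +
        cls (blockMap Φ f) (isIdempotentElem_blockMap Φ hf) := by
  rw [← cls_fromBlocks]
  refine cls_eq _ _ ?_
  have := matEquiv_submatrix
    (isIdempotentElem_blockMap Φ (isIdempotentElem_fromBlocks he hf))
    (Equiv.sumProdDistrib m n ι).symm
  convert this using 1
  ext (⟨a, i⟩ | ⟨a, i⟩) (⟨b, j⟩ | ⟨b, j⟩) <;> simp [blockMap_apply]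

/-- The map on `V` induced by a homomorphism from `A` to matrices over `B`. -/
noncomputable def map (Φ : A →ₙ+* Matrix ι ι B) : IdemClasses A →+ IdemClasses B where
  toFun := Quotient.lift
    (fun e : IdemMat A => cls (blockMap Φ e.mat) (isIdempotentElem_blockMap Φ e.idem))
    fun _ _ h => cls_eq _ _ (MatEquiv.blockMap Φ h)
  map_zero' := cls_of_isEmpty (ι := Fin 0 × ι) (isIdempotentElem_blockMap Φ (IdemMat.empty A).idem)
  map_add' a b := by
    obtain ⟨e, rfl⟩ := exists_eq_mk a
    obtain ⟨f, rfl⟩ := exists_eq_mk b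
    rw [mk_add_mk]
    simp only [mk, Quotient.lift_mk]
    rw [← cls_blockMap_add Φ e.idem f.idem]
    exact cls_eq _ _ (MatEquiv.blockMap Φ (IdemMat.matEquiv_directSum _ _).symm)

theorem map_cls (Φ : A →ₙ+* Matrix ι ι B) {e : Matrix n n A} (he : IsIdempotentElem e) :
    map Φ (cls e he) = cls (blockMap Φ e) (isIdempotentElem_blockMap Φ he) :=
  cls_eq _ _ (MatEquiv.blockMap Φ (matEquiv_submatrix he _).symm)

/-- A composite of two maps on `V` which is implemented by a conjugation is the identity. -/
theorem map_map_eq_self [Fintype κ] (Φ : A →ₙ+* Matrix ι ι B) (Ψ : B →ₙ+* Matrix κ κ A) (w z : ι → κ → A)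
    (h : ∀ a i i' j j', Ψ (Φ a i i') j j' = w i j * a * z i' j')
    (h1 : ∑ i, ∑ j, z i j * w i j = 1) (c : IdemClasses A) : map Ψ (map Φ c) = c := by
  obtain ⟨n, e, he, rfl⟩ := exists_eq_cls c
  rw [map_cls, map_cls]
  -- The composite sends `e` to `w e z` with `w` a column and `z` a row, so `x = w e` and `y = e z`
  -- work: `x y = w e z`, while `y x = e (∑ z w) e = e`.
  refine cls_eq _ _ ⟨Matrix.of fun a b => w a.1.2 a.2 * e a.1.1 b,
    Matrix.of fun a b => e a b.1.1 * z b.1.2 b.2, ?_, ?_⟩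
  · ext a b
    simp only [blockMap_apply, h, Matrix.mul_apply, Matrix.of_apply]
    conv_lhs => rw [← he.eq]
    simp only [Matrix.mul_apply, Finset.mul_sum, Finset.sum_mul, mul_assoc]
  · ext a b
    simp only [Matrix.mul_apply, Matrix.of_apply, Fintype.sum_prod_type]
    have : ∀ x i j, e a x * z i j * (w i j * e x b) = e a x * (z i j * w i j) * e x b := by
      intros
      simp only [mul_assoc]
    simp only [this, ← Finset.mul_sum, ← Finset.sum_mul, h1, mul_one]
    conv_lhs => rw [← he.eq]
    rfl

/-- A Morita equivalence induces an isomorphism on `V`. -/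
noncomputable def equivOfMorita [Fintype κ] (Φ : A →ₙ+* Matrix ι ι B) (Ψ : B →ₙ+* Matrix κ κ A)
    (w z : ι → κ → A) (h : ∀ a i i' j j', Ψ (Φ a i i') j j' = w i j * a * z i' j')
    (h1 : ∑ i, ∑ j, z i j * w i j = 1) (w' z' : κ → ι → B)
    (h' : ∀ b i i' j j', Φ (Ψ b i i') j j' = w' i j * b * z' i' j')
    (h1' : ∑ i, ∑ j, z' i j * w' i j = 1) : IdemClasses A ≃+ IdemClasses B where
  __ := map Φ
  invFun := map Ψ
  left_inv := map_map_eq_self Φ Ψ w z h h1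
  right_inv := map_map_eq_self Ψ Φ w' z' h' h1'

end IdemClasses

end Block

/-! ### Passage from `V` to the Grothendieck group. -/

namespace KZero

theorem lift_of {G : Type*} [AddCommGroup G] (f : IdemClasses A →+ G) (c : IdemClasses A) :
    Algebra.GrothendieckAddGroup.lift f (Algebra.GrothendieckAddGroup.of c) = f c := by
  have := Algebra.GrothendieckAddGroup.lift.symm_apply_apply f
  exact DFunLike.congr_fun this c

theorem hom_ext {G : Type*} [AddCommGroup G] {f g : KZero A →+ G}
    (h : ∀ c, f (Algebra.GrothendieckAddGroup.of c) = g (Algebra.GrothendieckAddGroup.of c)) :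
    f = g :=
  Algebra.GrothendieckAddGroup.lift.symm.injective (AddMonoidHom.ext h)

/-- An isomorphism of `V` induces one of `K_0`. -/
noncomputable def congr (f : IdemClasses A ≃+ IdemClasses B) : KZero A ≃+ KZero B :=
  AddMonoidHom.toAddEquiv
    (Algebra.GrothendieckAddGroup.lift (Algebra.GrothendieckAddGroup.of.comp f.toAddMonoidHom))
    (Algebra.GrothendieckAddGroup.lift
      (Algebra.GrothendieckAddGroup.of.comp f.symm.toAddMonoidHom))
    (hom_ext fun c => by
      simp only [AddMonoidHom.comp_apply, lift_of, AddMonoidHom.id_apply]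
      simp)
    (hom_ext fun c => by
      simp only [AddMonoidHom.comp_apply, lift_of, AddMonoidHom.id_apply]
      simp)

end KZero

/-! ### Traces -/

section Trace

variable {G : Type*} [AddCommGroup G]

theorem sum_diag_eq_of_matEquiv (t : A →+ G) (ht : ∀ a b, t (a * b) = t (b * a))
    {ι κ : Type*} [Fintype ι] [Fintype κ] {e : Matrix ι ι A} {f : Matrix κ κ A}
    (h : MatEquiv e f) : ∑ i, t (e i i) = ∑ i, t (f i i) := by
  obtain ⟨x, y, rfl, rfl⟩ := h
  simp only [Matrix.mul_apply, map_sum]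
  rw [Finset.sum_comm]
  simp only [ht]

/-- The homomorphism on `V(A)` induced by a trace. -/
def IdemClasses.trace (t : A →+ G) (ht : ∀ a b, t (a * b) = t (b * a)) : IdemClasses A →+ G where
  toFun := Quotient.lift (fun e : IdemMat A => ∑ i, t (e.mat i i))
    fun _ _ h => sum_diag_eq_of_matEquiv t ht h
  map_zero' := Finset.sum_empty
  map_add' a b := by
    obtain ⟨e, rfl⟩ := exists_eq_mk a
    obtain ⟨f, rfl⟩ := exists_eq_mk b
    rw [mk_add_mk]
    simp only [mk, Quotient.lift_mk]
    rw [← sum_diag_eq_of_matEquiv t ht (IdemMat.matEquiv_directSum _ _)]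
    simp

theorem IdemClasses.trace_cls (t : A →+ G) (ht : ∀ a b, t (a * b) = t (b * a))
    {ι : Type*} [Fintype ι] {e : Matrix ι ι A} (he : IsIdempotentElem e) :
    trace t ht (cls e he) = ∑ i, t (e i i) :=
  (sum_diag_eq_of_matEquiv t ht (matEquiv_submatrix he (Fintype.equivFin ι).symm)).symm

/-- If every element of `K_0(A)` is a multiple of a fixed one, then the values of a trace on
idempotents are multiples of a fixed value. -/
theorem KZero.exists_trace_eq_zsmul (t : A →+ G) (ht : ∀ a b, t (a * b) = t (b * a))
    (h : ∃ g : KZero A, ∀ x, ∃ k : ℤ, x = k • g) :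
    ∃ γ : G, ∀ a : A, IsIdempotentElem a → ∃ k : ℤ, t a = k • γ := by
  obtain ⟨g, hg⟩ := h
  refine ⟨Algebra.GrothendieckAddGroup.lift (IdemClasses.trace t ht) g, fun a ha => ?_⟩
  have he : IsIdempotentElem (Matrix.of fun _ _ : Unit => a) := by
    ext
    simp [Matrix.mul_apply, ha.eq]
  obtain ⟨k, hk⟩ := hg (Algebra.GrothendieckAddGroup.of (IdemClasses.cls _ he))
  refine ⟨k, ?_⟩
  rw [← map_zsmul, ← hk, lift_of, IdemClasses.trace_cls]
  simp

end Trace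

end KZeroFunctoriality

/-! ### Partial translations between `ℓ^p` spaces -/

section PartialTranslation

/-- A partial bijection takes each value at most once, so a sum pulled back along it has no repeated
terms. This is what makes the translation operators contractive. -/
theorem PEquiv.sum_elim_le {X Y : Type*} (e : Y ≃. X) (g : X → ℝ) (hg : ∀ x, 0 ≤ g x)
    (s : Finset Y) : ∃ t : Finset X, ∑ y ∈ s, (e y).elim 0 g ≤ ∑ x ∈ t, g x := by
  classical
  refine ⟨(s.image e).eraseNone, ?_⟩
  have h1 : ∑ y ∈ s.filter (fun y => (e y).isSome), (e y).elim 0 g = ∑ y ∈ s, (e y).elim 0 g := by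
    refine Finset.sum_filter_of_ne fun y _ h => ?_
    cases hy : e y with
    | none => simp [hy] at h
    | some x => rfl
  rw [← h1, ← Finset.sum_attach]
  have h2 : ∀ y ∈ (s.filter fun y => (e y).isSome), (e y).isSome := by
    intro y hy
    exact (Finset.mem_filter.1 hy).2
  let i : {y // y ∈ s.filter fun y => (e y).isSome} → X := fun y => (e y.1).get (h2 y y.2)
  have hi : ∀ y, e y.1 = some (i y) := fun y => (Option.some_get _).symm
  have hinj : Function.Injective i := by
    intro y z h
    refine Subtype.ext (e.inj (b := i y) (hi y) ?_)
    rw [h]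
    exact hi z
  have h3 : ∀ y, (e y.1).elim 0 g = g (i y) := fun y => by rw [hi y]; rfl
  rw [Finset.sum_congr rfl fun y _ => h3 y,
    ← Finset.sum_image (s := Finset.attach _) (f := g) (g := i) hinj.injOn]
  refine Finset.sum_le_sum_of_subset_of_nonneg ?_ fun x _ _ => hg x
  intro x hx
  obtain ⟨y, _, rfl⟩ := Finset.mem_image.1 hx
  rw [Finset.mem_eraseNone, Finset.mem_image]
  exact ⟨y.1, (Finset.mem_filter.1 y.2).1, hi y⟩

variable {X Y Z : Type*} {p : ℝ≥0∞} [Fact (1 ≤ p)]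

theorem toReal_pos_of_one_le (hp : p ≠ ⊤) : 0 < p.toReal :=
  ENNReal.toReal_pos (zero_lt_one.trans_le Fact.out).ne' hp

theorem PEquiv.sum_norm_rpow_le (hp : p ≠ ⊤) (e : Y ≃. X) (ξ : EllP X p) (s : Finset Y) :
    ∑ y ∈ s, ‖(e y).elim 0 ξ‖ ^ p.toReal ≤ ‖ξ‖ ^ p.toReal := by
  have h0 := toReal_pos_of_one_le hp
  obtain ⟨t, ht⟩ := e.sum_elim_le (fun x => ‖ξ x‖ ^ p.toReal)
    (fun x => Real.rpow_nonneg (norm_nonneg _) _) s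
  refine le_trans (le_of_eq (Finset.sum_congr rfl fun y _ => ?_))
    (ht.trans (lp.sum_rpow_le_norm_rpow h0 ξ t))
  cases e y with
  | none => simp [h0.ne']
  | some x => rfl

/-- The operator `ℓ^p(X) → ℓ^p(Y)` induced by a partial bijection from `Y` to `X`. -/
noncomputable def translationOp (hp : p ≠ ⊤) (e : Y ≃. X) : EllP X p →L[ℂ] EllP Y p :=
  LinearMap.mkContinuous
    { toFun := fun ξ => ⟨fun y => (e y).elim 0 ξ, memℓp_gen' (e.sum_norm_rpow_le hp ξ)⟩
      map_add' := fun ξ η => by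
        ext y
        change (e y).elim 0 ⇑(ξ + η) = (e y).elim 0 ξ + (e y).elim 0 η
        cases e y with
        | none => exact (add_zero (0 : ℂ)).symm
        | some x => rfl
      map_smul' := fun c ξ => by
        ext y
        change (e y).elim 0 ⇑(c • ξ) = c • (e y).elim 0 ξ
        cases e y with
        | none => exact (mul_zero c).symm
        | some x => rfl } 1
    fun ξ => by
      rw [one_mul]
      exact lp.norm_le_of_forall_sum_le (toReal_pos_of_one_le hp) (norm_nonneg _)
        (e.sum_norm_rpow_le hp ξ)

theorem translationOp_apply (hp : p ≠ ⊤) (e : Y ≃. X) (ξ : EllP X p) (y : Y) :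
    translationOp hp e ξ y = (e y).elim 0 ξ := rfl

theorem translationOp_comp (hp : p ≠ ⊤) (f : Z ≃. Y) (e : Y ≃. X) :
    (translationOp hp f).comp (translationOp hp e) = translationOp hp (f.trans e) := by
  refine ContinuousLinearMap.ext fun ξ => ?_
  ext z
  change (f z).elim 0 (translationOp hp e ξ) = ((f z).bind e).elim 0 ξ
  cases f z <;> rfl

open Classical in
theorem translationOp_single (hp : p ≠ ⊤) (e : Y ≃. X) (x : X) :
    translationOp hp e (lp.single p x (1 : ℂ)) =
      (e.symm x).elim 0 fun y => lp.single p y (1 : ℂ) := by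
  ext y
  rw [translationOp_apply]
  cases h : e y with
  | none =>
    cases h' : e.symm x with
    | none => rfl
    | some z =>
      have hz := (e.eq_some_iff).1 h'
      have : y ≠ z := by
        rintro rfl
        rw [h] at hz
        cases hz
      exact (lp.single_apply_ne (E := fun _ : _ => ℂ) p z (1 : ℂ) this).symm
  | some w =>
    by_cases hw : w = x
    · subst hw
      rw [(e.eq_some_iff).2 h]
      simp
    · cases h' : e.symm x with
      | none => exact lp.single_apply_ne (E := fun _ : _ => ℂ) p x (1 : ℂ) hw
      | some z =>
        have hz := (e.eq_some_iff).1 h'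
        have : y ≠ z := by
          rintro rfl
          rw [h] at hz
          exact hw (Option.some.inj hz)
        exact (lp.single_apply_ne (E := fun _ : _ => ℂ) p x (1 : ℂ) hw).trans
          (lp.single_apply_ne (E := fun _ : _ => ℂ) p z (1 : ℂ) this).symm

/-- A nonzero entry of a compression by partial translations comes from an entry of the original
operator. -/
theorem exists_of_opEntry_translationOp (hp : p ≠ ⊤) (e : Y ≃. X) (f : X ≃. Y)
    (T : EllP X p →L[ℂ] EllP X p) {y y' : Y}
    (h : opEntry ((translationOp hp e).comp (T.comp (translationOp hp f))) y y' ≠ 0) :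
    ∃ x x', e y = some x ∧ f x' = some y' ∧ opEntry T x x' ≠ 0 := by
  classical
  have h' : (e y).elim 0 (T (translationOp hp f (lp.single p y' (1 : ℂ)))) ≠ 0 := by
    unfold opEntry at h
    convert h using 2
    rfl
  rw [translationOp_single] at h'
  cases hx : e y with
  | none =>
    rw [hx] at h'
    exact absurd rfl h'
  | some x =>
    cases hx' : f.symm y' with
    | none =>
      rw [hx, hx'] at h'
      have h0 : T 0 x = 0 := by
        rw [map_zero]
        rfl
      exact absurd h0 h'
    | some x' =>
      refine ⟨x, x', rfl, (f.eq_some_iff).1 hx', ?_⟩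
      rw [hx, hx'] at h'
      unfold opEntry
      convert h' using 2
      rfl

theorem exists_of_opEntry_translationOp_self (hp : p ≠ ⊤) (e : X ≃. X) {x y : X}
    (h : opEntry (translationOp hp e) x y ≠ 0) : e x = some y := by
  -- A translation is a compression of the identity, whose nonzero entries lie on the diagonal.
  have : translationOp hp e = (translationOp hp e).comp
      ((ContinuousLinearMap.id ℂ (EllP X p)).comp (translationOp hp (PEquiv.refl X))) := by
    refine ContinuousLinearMap.ext fun ξ => ?_
    rfl
  rw [this] at h
  obtain ⟨a, b, h1, h2, h3⟩ := exists_of_opEntry_translationOp hp e _ _ h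
  rw [h1, ← h2]
  by_cases hab : a = b
  · rw [hab]
    rfl
  · exact absurd (opEntry_algebraMap (p := p) 1 hab) (by rw [map_one]; exact h3)

end PartialTranslation

/-! ### Finite propagation -/

section Propagation

variable {X Y : Type*} [MetricSpace X] [MetricSpace Y] {p : ℝ≥0∞} [Fact (1 ≤ p)]

theorem mem_finitePropagationAlgebra_iff (hp : p ≠ ⊤) {T : EllP X p →L[ℂ] EllP X p} :
    T ∈ finitePropagationAlgebra X p hp ↔
      ∃ R : ℝ, 0 < R ∧ ∀ x y, opEntry T x y ≠ 0 → dist x y ≤ R := by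
  constructor
  · intro h
    have h' : propagation T < ⊤ := h
    refine ⟨(propagation T).toReal + 1, by positivity, fun x y hxy => ?_⟩
    have h1 := ENNReal.toReal_mono h'.ne (edist_le_propagation T hxy)
    rw [edist_dist, ENNReal.toReal_ofReal dist_nonneg] at h1
    linarith
  · rintro ⟨R, _, h⟩
    refine lt_of_le_of_lt (propagation_le (r := ENNReal.ofReal R) T fun x y hxy => ?_)
      ENNReal.ofReal_lt_top
    rw [edist_dist]
    exact ENNReal.ofReal_le_ofReal (h x y hxy)

theorem mem_uniformRoeAlgebra_of_mem (hp : p ≠ ⊤) {T : EllP X p →L[ℂ] EllP X p}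
    (h : T ∈ finitePropagationAlgebra X p hp) : T ∈ uniformRoeAlgebra X p hp :=
  Subalgebra.le_topologicalClosure _ h

/-- A partial bijection whose graph is at bounded distance from the diagonal gives an element of
the uniform Roe algebra. -/
theorem translationOp_mem_uniformRoeAlgebra (hp : p ≠ ⊤) (e : X ≃. X) {R : ℝ} (hR : 0 < R)
    (h : ∀ x y, e x = some y → dist x y ≤ R) : translationOp hp e ∈ uniformRoeAlgebra X p hp :=
  mem_uniformRoeAlgebra_of_mem hp ((mem_finitePropagationAlgebra_iff hp).2
    ⟨R, hR, fun _ _ hxy => h _ _ (exists_of_opEntry_translationOp_self hp e hxy)⟩)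

/-- Compression is norm continuous, so it suffices to treat operators of finite propagation. For
these, distances have to be controlled only between points matched by `e` and `f`. -/
theorem compress_mem_uniformRoeAlgebra (hp : p ≠ ⊤) (e : Y ≃. X) (f : X ≃. Y)
    (h : ∀ R : ℝ, 0 < R → ∃ S : ℝ, 0 < S ∧ ∀ x x' y y', e y = some x → f x' = some y' →
      dist x x' ≤ R → dist y y' ≤ S) {T : EllP X p →L[ℂ] EllP X p}
    (hT : T ∈ uniformRoeAlgebra X p hp) :
    (translationOp hp e).comp (T.comp (translationOp hp f)) ∈ uniformRoeAlgebra Y p hp := by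
  refine map_mem_closure (f := fun T : EllP X p →L[ℂ] EllP X p =>
    (translationOp hp e).comp (T.comp (translationOp hp f))) ?_ hT ?_
  · exact ((ContinuousLinearMap.compL ℂ _ _ _ (translationOp hp e)).continuous).comp
      (((ContinuousLinearMap.compL ℂ (EllP Y p) (EllP X p) (EllP X p)).flip
        (translationOp hp f)).continuous)
  · intro T hT
    obtain ⟨R, hR, hT⟩ := (mem_finitePropagationAlgebra_iff hp).1 hT
    obtain ⟨S, hS, h⟩ := h R hR
    refine (mem_finitePropagationAlgebra_iff hp).2 ⟨S, hS, fun y y' hy => ?_⟩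
    obtain ⟨x, x', h1, h2, h3⟩ := exists_of_opEntry_translationOp hp e f T hy
    exact h x x' y y' h1 h2 (hT _ _ h3)

end Propagation

/-! ### Coarse invariance -/

section CoarseInvariance

/-! ### Splitting a map into partial bijections by a colouring. -/

section Graph

variable {X Y ι : Type*} (f : X → Y) (c : X → ι) (hc : ∀ x x', f x = f x' → c x = c x' → x = x')

open Classical in
/-- The graph of the restriction of `f` to the points of colour `i`, as a partial bijection, where
`f` is injective on each colour class. -/
noncomputable def graphPEquiv (hc : ∀ x x', f x = f x' → c x = c x' → x = x') (i : ι) : X ≃. Y where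
  toFun x := if c x = i then some (f x) else none
  invFun y := if h : ∃ x, f x = y ∧ c x = i then some h.choose else none
  inv x y := by
    constructor
    · intro h
      by_cases hy : ∃ x, f x = y ∧ c x = i
      · rw [dif_pos hy] at h
        cases h
        rw [if_pos hy.choose_spec.2, hy.choose_spec.1]
      · rw [dif_neg hy] at h
        cases h
    · intro h
      by_cases hx : c x = i
      · rw [if_pos hx] at h
        cases h
        have hy : ∃ x', f x' = f x ∧ c x' = i := ⟨x, rfl, hx⟩
        rw [dif_pos hy, hc _ _ hy.choose_spec.1 (hy.choose_spec.2.trans hx.symm)]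
      · rw [if_neg hx] at h
        cases h

open Classical in
theorem graphPEquiv_eq_some {i : ι} {x : X} {y : Y} :
    graphPEquiv f c hc i x = some y ↔ c x = i ∧ f x = y := by
  change (if c x = i then some (f x) else none) = some y ↔ _
  by_cases h : c x = i <;> simp [h]

theorem graphPEquiv_symm_eq_some {i : ι} {x : X} {y : Y} :
    (graphPEquiv f c hc i).symm y = some x ↔ c x = i ∧ f x = y := by
  rw [PEquiv.eq_some_iff, graphPEquiv_eq_some]

variable {p : ℝ≥0∞} [Fact (1 ≤ p)]

/-- The `i`-th summand is the projection onto the functions supported on colour `i`. The opposite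
products project onto images of colour classes, which may overlap, so the homomorphisms built from
these operators need not be unital. -/
theorem sum_translationOp_graphPEquiv [Fintype ι] (hp : p ≠ ⊤) :
    ∑ i, (translationOp hp (graphPEquiv f c hc i)).comp
      (translationOp hp (graphPEquiv f c hc i).symm) = ContinuousLinearMap.id ℂ (EllP X p) := by
  classical
  refine ContinuousLinearMap.ext fun ξ => ?_
  ext x
  rw [sum_apply, lp.coeFn_sum, Finset.sum_apply,
    Finset.sum_eq_single_of_mem (c x) (Finset.mem_univ _)]
  · rw [translationOp_comp, translationOp_apply]
    have : ((graphPEquiv f c hc (c x)).trans (graphPEquiv f c hc (c x)).symm) x = some x := by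
      rw [PEquiv.trans_eq_some]
      exact ⟨f x, (graphPEquiv_eq_some f c hc).2 ⟨rfl, rfl⟩,
        (graphPEquiv_symm_eq_some f c hc).2 ⟨rfl, rfl⟩⟩
    rw [this]
    rfl
  · intro i _ hi
    rw [translationOp_comp, translationOp_apply]
    have : ((graphPEquiv f c hc i).trans (graphPEquiv f c hc i).symm) x = none := by
      rw [PEquiv.trans_eq_none]
      intro y x'
      by_cases h : graphPEquiv f c hc i x = some y
      · exact absurd ((graphPEquiv_eq_some f c hc).1 h).1.symm hi
      · exact Or.inl h
    rw [this]
    rfl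

end Graph

variable {X Y : Type*} [MetricSpace X] [MetricSpace Y] {p : ℝ≥0∞} [Fact (1 ≤ p)]
  {ι κ : Type*} [Fintype ι] [Fintype κ]

/-- The homomorphism `B^p_u(X) → M_ι(B^p_u(Y))` implemented by a uniformly expansive map that is
injective on each of the classes of a colouring by `ι`. -/
noncomputable def coarseHom (hp : p ≠ ⊤) (f : X → Y) (hf : UniformlyExpansive f) (c : X → ι)
    (hc : ∀ x x', f x = f x' → c x = c x' → x = x') :
    uniformRoeAlgebra X p hp →ₙ+* Matrix ι ι (uniformRoeAlgebra Y p hp) where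
  toFun a := Matrix.of fun i j =>
    ⟨(translationOp hp (graphPEquiv f c hc i).symm).comp
      (a.1.comp (translationOp hp (graphPEquiv f c hc j))),
      compress_mem_uniformRoeAlgebra hp _ _ (fun R hR => by
        obtain ⟨S, hS, h⟩ := hf R hR
        refine ⟨S, hS, fun x x' y y' h1 h2 h3 => ?_⟩
        rw [← ((graphPEquiv_symm_eq_some f c hc).1 h1).2,
          ← ((graphPEquiv_eq_some f c hc).1 h2).2]
        exact h x x' h3) a.2⟩
  map_zero' := by
    ext i j : 2
    change ContinuousLinearMap.comp _ (ContinuousLinearMap.comp 0 _) = 0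
    rw [ContinuousLinearMap.zero_comp, ContinuousLinearMap.comp_zero]
  map_add' a b := by
    ext i j : 2
    change ContinuousLinearMap.comp _ (ContinuousLinearMap.comp (a.1 + b.1) _) =
      ContinuousLinearMap.comp _ (ContinuousLinearMap.comp a.1 _) +
      ContinuousLinearMap.comp _ (ContinuousLinearMap.comp b.1 _)
    rw [ContinuousLinearMap.add_comp, ContinuousLinearMap.comp_add]
  map_mul' a b := by
    ext i j : 2
    rw [Matrix.mul_apply, AddSubmonoidClass.coe_finsetSum]
    refine ContinuousLinearMap.ext fun ξ => ?_
    rw [sum_apply]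
    -- The colour projections, which sum to the identity, are inserted between `a` and `b`.
    have h := DFunLike.congr_fun (sum_translationOp_graphPEquiv f c hc hp)
      (b.1 (translationOp hp (graphPEquiv f c hc j) ξ))
    rw [sum_apply] at h
    change translationOp hp (graphPEquiv f c hc i).symm
      (a.1 (b.1 (translationOp hp (graphPEquiv f c hc j) ξ))) = _
    conv_lhs => rw [← ContinuousLinearMap.id_apply (R₁ := ℂ)
      (b.1 (translationOp hp (graphPEquiv f c hc j) ξ)), ← h, map_sum, map_sum]
    rfl

theorem coarseHom_apply (hp : p ≠ ⊤) (f : X → Y) (hf : UniformlyExpansive f) (c : X → ι)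
    (hc : ∀ x x', f x = f x' → c x = c x' → x = x') (a : uniformRoeAlgebra X p hp) (i j : ι) :
    (coarseHom hp f hf c hc a i j).1 = (translationOp hp (graphPEquiv f c hc i).symm).comp
      (a.1.comp (translationOp hp (graphPEquiv f c hc j))) := rfl

/-- The conjugating elements are translations along restrictions of `g ∘ f` and their inverses.
Closeness of `g ∘ f` to the identity bounds their displacement, which puts them in the Roe algebra.
The normalisation follows by summing the colour projections for `g` and then those for `f`. -/
theorem exists_coarseHom_coarseHom_eq (hp : p ≠ ⊤) (f : X → Y) (hf : UniformlyExpansive f)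
    (c : X → ι) (hc : ∀ x x', f x = f x' → c x = c x' → x = x') (g : Y → X)
    (hg : UniformlyExpansive g) (d : Y → κ) (hd : ∀ y y', g y = g y' → d y = d y' → y = y')
    (h : CloseMaps (g ∘ f) id) : ∃ w z : ι → κ → uniformRoeAlgebra X p hp,
      (∀ a i i' j j', coarseHom hp g hg d hd (coarseHom hp f hf c hc a i i') j j' =
        w i j * a * z i' j') ∧ ∑ i, ∑ j, z i j * w i j = 1 := by
  obtain ⟨C, hC, h⟩ := h
  refine ⟨fun i j => ⟨translationOp hp
      ((graphPEquiv g d hd j).symm.trans (graphPEquiv f c hc i).symm),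
      translationOp_mem_uniformRoeAlgebra hp _ hC ?_⟩,
    fun i j => ⟨translationOp hp ((graphPEquiv f c hc i).trans (graphPEquiv g d hd j)),
      translationOp_mem_uniformRoeAlgebra hp _ hC ?_⟩, ?_, ?_⟩
  · intro x x' hx
    obtain ⟨y, h1, h2⟩ := (PEquiv.trans_eq_some _ _ _ _).1 hx
    have h1 := ((graphPEquiv_symm_eq_some g d hd).1 h1).2
    have h2 := ((graphPEquiv_symm_eq_some f c hc).1 h2).2
    rw [← h1, ← h2]
    exact h x'
  · intro x x' hx
    obtain ⟨y, h1, h2⟩ := (PEquiv.trans_eq_some _ _ _ _).1 hx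
    have h1 := ((graphPEquiv_eq_some f c hc).1 h1).2
    have h2 := ((graphPEquiv_eq_some g d hd).1 h2).2
    rw [← h2, ← h1, dist_comm]
    exact h x
  · intro a i i' j j'
    refine Subtype.ext ?_
    rw [coarseHom_apply, coarseHom_apply]
    change _ = ((translationOp hp _).comp a.1).comp (translationOp hp _)
    rw [← translationOp_comp, ← translationOp_comp]
    rfl
  · refine Subtype.ext (ContinuousLinearMap.ext fun ξ => ?_)
    rw [AddSubmonoidClass.coe_finsetSum, sum_apply]
    have hX := DFunLike.congr_fun (sum_translationOp_graphPEquiv f c hc hp) ξ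
    rw [sum_apply] at hX
    refine Eq.trans (Finset.sum_congr rfl fun i _ => ?_) hX
    rw [AddSubmonoidClass.coe_finsetSum, sum_apply]
    have hY := DFunLike.congr_fun (sum_translationOp_graphPEquiv g d hd hp)
      (translationOp hp (graphPEquiv f c hc i).symm ξ)
    rw [sum_apply] at hY
    have hY' := congrArg (translationOp hp (graphPEquiv f c hc i)) hY
    rw [map_sum] at hY'
    refine Eq.trans (Finset.sum_congr rfl fun j _ => ?_) hY'
    change translationOp hp _ (translationOp hp _ ξ) = _
    rw [← translationOp_comp, ← translationOp_comp]
    rfl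

/-- Coarse invariance of `K_0` of the `ℓ^p` uniform Roe algebra, for coarse equivalences with
finitely colourable fibres. -/
theorem nonempty_kZero_addEquiv_of_colouring (hp : p ≠ ⊤) (f : X → Y) (hf : UniformlyExpansive f)
    (c : X → ι) (hc : ∀ x x', f x = f x' → c x = c x' → x = x') (g : Y → X)
    (hg : UniformlyExpansive g) (d : Y → κ) (hd : ∀ y y', g y = g y' → d y = d y' → y = y')
    (hfg : CloseMaps (f ∘ g) id) (hgf : CloseMaps (g ∘ f) id) :
    Nonempty (KZero (uniformRoeAlgebra X p hp) ≃+ KZero (uniformRoeAlgebra Y p hp)) := by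
  obtain ⟨w, z, h, h1⟩ := exists_coarseHom_coarseHom_eq hp f hf c hc g hg d hd hgf
  obtain ⟨w', z', h', h1'⟩ := exists_coarseHom_coarseHom_eq hp g hg d hd f hf c hc hfg
  exact ⟨KZero.congr (IdemClasses.equivOfMorita _ _ w z h h1 w' z' h' h1')⟩

/-- A map with fibres of diameter at most `C` into a space whose balls of radius `C` have at most
`N` points is injective on the classes of a finite colouring. -/
theorem exists_colouring {Y : Type*} {C : ℝ} {N : ℕ} (f : X → Y) (hf : ∀ x x', f x = f x' → dist x x' ≤ C)
    (hN : ∀ x : X, (Metric.closedBall x C).encard ≤ N) :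
    ∃ c : X → Fin N, ∀ x x', f x = f x' → c x = c x' → x = x' := by
  have key : ∀ y, ∃ φ : X → Fin N, Set.InjOn φ (f ⁻¹' {y}) := by
    intro y
    rcases (f ⁻¹' {y}).eq_empty_or_nonempty with h | ⟨x₀, hx₀⟩
    -- On an empty fibre any map into `Fin N` will do. It exists because a nonempty `X` forces `N >
    -- 0`.
    · by_cases hX : Nonempty X
      · obtain ⟨x⟩ := hX
        have h1 : (1 : ℕ∞) ≤ N := by
          refine le_trans ?_ (hN x)
          have := hf x x rfl
          rw [dist_self] at this
          exact Set.one_le_encard_iff_nonempty.2 ⟨x, Metric.mem_closedBall_self this⟩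
        have h1 : 0 < N := by exact_mod_cast h1
        exact ⟨fun _ => ⟨0, h1⟩, by rw [h]; exact Set.injOn_empty _⟩
      · exact ⟨fun x => (hX ⟨x⟩).elim, fun x => (hX ⟨x⟩).elim⟩
    · have hsub : f ⁻¹' {y} ⊆ Metric.closedBall x₀ C := by
        intro x hx
        exact hf x x₀ ((Set.mem_singleton_iff.1 hx).trans (Set.mem_singleton_iff.1 hx₀).symm)
      have hcard : (f ⁻¹' {y}).encard ≤ N := (Set.encard_le_encard hsub).trans (hN x₀)
      have hfin : (f ⁻¹' {y}).Finite := Set.finite_of_encard_le_coe hcard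
      have : (f ⁻¹' {y}).encard ≤ (Set.univ : Set (Fin N)).encard := by
        rwa [Set.encard_univ, ENat.card_eq_coe_fintype_card, Fintype.card_fin]
      have hne : Nonempty (Fin N) := by
        by_contra hne
        rw [not_nonempty_iff] at hne
        rw [Set.univ_eq_empty_iff.2 hne, Set.encard_empty, nonpos_iff_eq_zero,
          Set.encard_eq_zero] at this
        rw [this] at hx₀
        exact hx₀
      obtain ⟨φ, _, hφ⟩ := hfin.exists_injOn_of_encard_le this
      exact ⟨φ, hφ⟩
  choose φ hφ using key
  refine ⟨fun x => φ (f x) x, fun x x' h h' => ?_⟩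
  refine hφ (f x) rfl h.symm ?_
  exact h'.trans (by rw [h])

theorem dist_le_of_apply_eq {Y : Type*} {f : X → Y} {g : Y → X} {C : ℝ}
    (h : ∀ x, dist ((g ∘ f) x) (id x) ≤ C) (x x' : X) (hx : f x = f x') :
    dist x x' ≤ C + C := by
  refine (dist_triangle_left x x' (g (f x))).trans (add_le_add (h x) ?_)
  rw [hx]
  exact h x'

/-- Coarsely equivalent spaces of bounded geometry have uniform Roe algebras with isomorphic
`K_0` groups. -/
theorem nonempty_kZero_addEquiv_of_coarselyEquivalent
    (hX : ∀ R : ℝ, ∃ N : ℕ, ∀ x : X, (Metric.closedBall x R).encard ≤ N)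
    (hY : ∀ R : ℝ, ∃ N : ℕ, ∀ y : Y, (Metric.closedBall y R).encard ≤ N)
    (h : CoarselyEquivalent X Y) (hp : p ≠ ⊤) :
    Nonempty (KZero (uniformRoeAlgebra X p hp) ≃+ KZero (uniformRoeAlgebra Y p hp)) := by
  obtain ⟨f, g, hf, hg, hfg, hgf⟩ := h
  have hfg' := hfg
  have hgf' := hgf
  obtain ⟨C, _, hfg'⟩ := hfg'
  obtain ⟨D, _, hgf'⟩ := hgf'
  obtain ⟨M, hM⟩ := hX (D + D)
  obtain ⟨N, hN⟩ := hY (C + C)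
  obtain ⟨c, hc⟩ := exists_colouring f (dist_le_of_apply_eq hgf') hM
  obtain ⟨d, hd⟩ := exists_colouring g (dist_le_of_apply_eq hfg') hN
  exact nonempty_kZero_addEquiv_of_colouring hp f hf c hc g hg d hd hfg hgf

end CoarseInvariance

/-! ### Finite groups -/

section FiniteSpaces

theorem uniformlyExpansive_const {X Y : Type*} [MetricSpace X] [MetricSpace Y] (y : Y) :
    UniformlyExpansive fun _ : X => y :=
  fun _ _ => ⟨1, one_pos, fun _ _ => by simp⟩

theorem closeMaps_of_finite {X Y : Type*} [MetricSpace Y] [Finite Y] (f g : X → Y) :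
    CloseMaps f g := by
  obtain ⟨C, hC⟩ := ((Set.finite_range fun y : Y × Y => dist y.1 y.2).bddAbove)
  refine ⟨max C 1, lt_max_of_lt_right one_pos, fun x => ?_⟩
  exact le_max_of_le_left (hC ⟨(f x, g x), rfl⟩)

theorem coarselyEquivalent_of_finite (X Y : Type*) [MetricSpace X] [MetricSpace Y] [Finite X]
    [Finite Y] [Nonempty X] [Nonempty Y] : CoarselyEquivalent X Y :=
  ⟨fun _ => Classical.arbitrary Y, fun _ => Classical.arbitrary X, uniformlyExpansive_const _,
    uniformlyExpansive_const _, closeMaps_of_finite _ _, closeMaps_of_finite _ _⟩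

theorem exists_encard_closedBall_le_of_finite (X : Type*) [MetricSpace X] [Finite X] (R : ℝ) :
    ∃ N : ℕ, ∀ x : X, (Metric.closedBall x R).encard ≤ N := by
  refine ⟨Nat.card X, fun x => (Set.encard_le_encard (Set.subset_univ _)).trans ?_⟩
  rw [Set.encard_univ, ENat.card_eq_coe_natCard]

end FiniteSpaces

/-! ### `K_0` of a field is cyclic. -/

section FieldKZero

open Matrix in
/-- An idempotent matrix over a field is equivalent to an identity matrix. -/
theorem exists_matEquiv_one {K : Type*} [Field K] {n : ℕ} {e : Matrix (Fin n) (Fin n) K}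
    (he : IsIdempotentElem e) : ∃ r : ℕ, MatEquiv e (1 : Matrix (Fin r) (Fin r) K) := by
  set T : (Fin n → K) →ₗ[K] (Fin n → K) := Matrix.toLin' e with hT
  have hTT : T ∘ₗ T = T := by
    rw [hT, ← Matrix.toLin'_mul, he.eq]
  let b := (Module.finBasis K (LinearMap.range T)).equivFun
  let x : (Fin _ → K) →ₗ[K] (Fin n → K) := (LinearMap.range T).subtype ∘ₗ b.symm.toLinearMap
  let y : (Fin n → K) →ₗ[K] (Fin _ → K) := b.toLinearMap ∘ₗ T.rangeRestrict
  have hxy : x ∘ₗ y = T := by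
    refine LinearMap.ext fun v => ?_
    simp [x, y]
  have hyx : y ∘ₗ x = LinearMap.id := by
    refine LinearMap.ext fun v => ?_
    -- An idempotent fixes every vector of its range.
    have : T.rangeRestrict (b.symm v : Fin n → K) = b.symm v := by
      obtain ⟨u, hu⟩ := (b.symm v).2
      refine Subtype.ext ?_
      change T (b.symm v) = b.symm v
      rw [← hu]
      exact LinearMap.congr_fun hTT u
    simp [x, y, this]
  refine ⟨_, LinearMap.toMatrix' x, LinearMap.toMatrix' y, ?_, ?_⟩
  · rw [← LinearMap.toMatrix'_comp, hxy, hT, LinearMap.toMatrix'_toLin']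
  · rw [← LinearMap.toMatrix'_comp, hyx, LinearMap.toMatrix'_id]

theorem isIdempotentElem_one_matrix {A : Type*} [Ring A] (ι : Type*) [Fintype ι] [DecidableEq ι] :
    IsIdempotentElem (1 : Matrix ι ι A) := mul_one _

theorem IdemClasses.cls_one_eq_nsmul {A : Type*} [Ring A] (r : ℕ) :
    cls (1 : Matrix (Fin r) (Fin r) A) (isIdempotentElem_one_matrix _) =
      r • cls (1 : Matrix (Fin 1) (Fin 1) A) (isIdempotentElem_one_matrix _) := by
  induction r with
  | zero => rw [zero_smul, cls_of_isEmpty]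
  | succ r ih =>
    rw [succ_nsmul, ← ih, ← cls_fromBlocks]
    have := matEquiv_submatrix (isIdempotentElem_one_matrix (A := A) (Fin (r + 1)))
      (finSumFinEquiv (m := r) (n := 1))
    refine cls_eq _ _ ?_
    rw [Matrix.fromBlocks_one]
    rwa [Matrix.submatrix_one_equiv] at this

/-- A ring isomorphism, as a homomorphism to one by one matrices. -/
def RingEquiv.toMatrixHom {A B : Type*} [Ring A] [Ring B] (σ : A ≃+* B) :
    A →ₙ+* Matrix Unit Unit B where
  toFun a := Matrix.of fun _ _ => σ a
  map_mul' a b := by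
    ext
    simp [Matrix.mul_apply]
  map_zero' := by
    ext
    simp
  map_add' a b := by
    ext
    simp

theorem exists_forall_kZero_eq_zsmul_of_ringEquiv {K A : Type*} [Field K] [Ring A] (σ : K ≃+* A) :
    ∃ g : KZero A, ∀ x, ∃ k : ℤ, x = k • g := by
  let E : IdemClasses K ≃+ IdemClasses A := IdemClasses.equivOfMorita σ.toMatrixHom
    σ.symm.toMatrixHom (fun _ _ => 1) (fun _ _ => 1)
    (fun a _ _ _ _ => by
      rw [one_mul, mul_one]
      exact σ.symm_apply_apply a) (by simp) (fun _ _ => 1) (fun _ _ => 1)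
    (fun a _ _ _ _ => by
      rw [one_mul, mul_one]
      exact σ.apply_symm_apply a) (by simp)
  let u := E (IdemClasses.cls (1 : Matrix (Fin 1) (Fin 1) K) (isIdempotentElem_one_matrix _))
  let g : KZero A := Algebra.GrothendieckAddGroup.of u
  -- Cyclicity is phrased as the vanishing of the quotient map modulo `g`, which can be tested on
  -- classes of idempotents.
  have hq : QuotientAddGroup.mk' (AddSubgroup.zmultiples g) = 0 := by
    refine KZero.hom_ext fun c => ?_
    obtain ⟨c, rfl⟩ := E.surjective c
    obtain ⟨n, e, he, rfl⟩ := IdemClasses.exists_eq_cls c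
    obtain ⟨r, hr⟩ := exists_matEquiv_one he
    rw [IdemClasses.cls_eq he (isIdempotentElem_one_matrix _) hr, IdemClasses.cls_one_eq_nsmul,
      map_nsmul, map_nsmul, map_nsmul]
    have : QuotientAddGroup.mk' (AddSubgroup.zmultiples g) g = 0 :=
      (QuotientAddGroup.eq_zero_iff g).2 (AddSubgroup.mem_zmultiples g)
    exact (congrArg (r • ·) this).trans (smul_zero r)
  refine ⟨g, fun x => ?_⟩
  have hx : QuotientAddGroup.mk' (AddSubgroup.zmultiples g) x = 0 := DFunLike.congr_fun hq x
  obtain ⟨k, hk⟩ := AddSubgroup.mem_zmultiples_iff.1 ((QuotientAddGroup.eq_zero_iff x).1 hx)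
  exact ⟨k, hk.symm⟩

end FieldKZero

/-! ### The Roe algebra of a point, and of a finite space. -/

section FiniteRoe

variable {p : ℝ≥0∞} [Fact (1 ≤ p)]

theorem algebraMap_uniformRoeAlgebra_unit_bijective (hp : p ≠ ⊤) :
    Function.Bijective (algebraMap ℂ (uniformRoeAlgebra Unit p hp)) := by
  classical
  have key : ∀ ξ : EllP Unit p, ξ = ξ () • lp.single (E := fun _ : Unit => ℂ) p () (1 : ℂ) := by
    intro ξ
    ext x
    rw [lp.coeFn_smul, Pi.smul_apply, lp.single_apply_self]
    simp
  constructor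
  · intro a b h
    have h1 := congrArg Subtype.val h
    have h2 := DFunLike.congr_fun h1 (lp.single (E := fun _ : Unit => ℂ) p () (1 : ℂ))
    have h3 : (a • lp.single (E := fun _ : Unit => ℂ) p () (1 : ℂ)) () =
      (b • lp.single (E := fun _ : Unit => ℂ) p () (1 : ℂ)) () := congrArg (fun ξ => ξ ()) h2
    simpa [lp.coeFn_smul] using h3
  · intro T
    refine ⟨T.1 (lp.single (E := fun _ : Unit => ℂ) p () (1 : ℂ)) (), Subtype.ext ?_⟩
    refine ContinuousLinearMap.ext fun ξ => ?_
    change T.1 (lp.single (E := fun _ : Unit => ℂ) p () (1 : ℂ)) () • ξ = T.1 ξ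
    conv_rhs => rw [key ξ, map_smul, key (T.1 _), smul_comm, ← key ξ]

/-- The `K_0` group of the uniform Roe algebra of a finite space is cyclic. -/
theorem exists_forall_kZero_eq_zsmul_of_finite (X : Type*) [MetricSpace X] [Finite X] [Nonempty X]
    (hp : p ≠ ⊤) : ∃ g : KZero (uniformRoeAlgebra X p hp), ∀ x, ∃ k : ℤ, x = k • g := by
  obtain ⟨E⟩ := nonempty_kZero_addEquiv_of_coarselyEquivalent
    (exists_encard_closedBall_le_of_finite X) (exists_encard_closedBall_le_of_finite Unit)
    (coarselyEquivalent_of_finite X Unit) hp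
  obtain ⟨g, hg⟩ := exists_forall_kZero_eq_zsmul_of_ringEquiv
    (RingEquiv.ofBijective _ (algebraMap_uniformRoeAlgebra_unit_bijective hp))
  refine ⟨E.symm g, fun x => ?_⟩
  obtain ⟨k, hk⟩ := hg (E x)
  exact ⟨k, by rw [← map_zsmul, ← hk, E.symm_apply_apply]⟩

end FiniteRoe

/-! ### Proper left-invariant metrics on countable groups -/

section ProperGroup

theorem exists_finite_subgroup {G : Type*} [Group G] (hG : IsLocallyFiniteGroup G) {s : Set G} (hs : s.Finite) :
    ∃ H : Subgroup G, Finite H ∧ s ⊆ H :=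
  ⟨Subgroup.closure s, hG _ ⟨hs.toFinset, by simp⟩, Subgroup.subset_closure⟩

variable {G : Type*} [Group G] [MetricSpace G] [IsIsometricSMul G G]

theorem dist_one_inv_mul (x y : G) : dist 1 (x⁻¹ * y) = dist x y := by
  have := dist_smul x⁻¹ x y
  simpa using this

theorem exists_dist_le_of_finite (H : Set G) (hH : H.Finite) :
    ∃ S : ℝ, 0 < S ∧ ∀ x y : G, x⁻¹ * y ∈ H → dist x y ≤ S := by
  obtain ⟨C, hC⟩ := (hH.image fun h => dist 1 h).bddAbove
  refine ⟨max C 1, lt_max_of_lt_right one_pos, fun x y hxy => le_max_of_le_left ?_⟩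
  rw [← dist_one_inv_mul]
  exact hC ⟨_, hxy, rfl⟩

variable [Countable G] [ProperSpace G]

/-- By Baire's theorem one of the countably many closed singletons has nonempty interior, and left
translations move this isolated point anywhere. Closed balls are then compact and discrete, hence
finite. -/
theorem discreteTopology_of_countable_of_proper : DiscreteTopology G := by
  have hU : ⋃ x : G, ({x} : Set G) = Set.univ := Set.iUnion_of_singleton G
  obtain ⟨x, y, hy⟩ := nonempty_interior_of_iUnion_of_closed (fun x : G => isClosed_singleton) hU
  have hyx : y = x := interior_subset (s := {x}) hy
  subst hyx
  have hopen : IsOpen ({y} : Set G) := by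
    rw [← interior_eq_iff_isOpen]
    exact (interior_subset).antisymm (Set.singleton_subset_iff.2 hy)
  refine discreteTopology_iff_isOpen_singleton.2 fun z => ?_
  have h := (IsometryEquiv.constSMul (z * y⁻¹) : G ≃ᵢ G).toHomeomorph.isOpenMap _ hopen
  simpa using h

theorem finite_closedBall (x : G) (R : ℝ) : (Metric.closedBall x R).Finite := by
  have := discreteTopology_of_countable_of_proper (G := G)
  exact (isCompact_closedBall x R).finite_of_discrete

theorem exists_encard_closedBall_le (G : Type*) [Group G] [MetricSpace G] [IsIsometricSMul G G]
    [Countable G] [ProperSpace G] (R : ℝ) :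
    ∃ N : ℕ, ∀ x : G, (Metric.closedBall x R).encard ≤ N := by
  refine ⟨(Metric.closedBall (1 : G) R).ncard, fun x => ?_⟩
  rw [(finite_closedBall (1 : G) R).cast_ncard_eq]
  have : Metric.closedBall x R ⊆ (fun y => x * y) '' Metric.closedBall 1 R := by
    intro y hy
    refine ⟨x⁻¹ * y, ?_, by simp⟩
    rw [Metric.mem_closedBall, dist_comm, dist_one_inv_mul, dist_comm]
    exact hy
  exact (Set.encard_le_encard this).trans (Set.encard_image_le _ _)

end ProperGroup

open Filter Topology

/-! ### Traces on the uniform Roe algebra of an infinite locally finite group -/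

section RoeTrace

section Entries

variable {X : Type*} {p : ℝ≥0∞} [Fact (1 ≤ p)]

theorem opEntry_eq [h : DecidableEq X] (T : EllP X p →L[ℂ] EllP X p) (x y : X) :
    opEntry T x y = T (lp.single p y (1 : ℂ)) x := by
  obtain rfl : h = fun a b => Classical.propDecidable (a = b) := Subsingleton.elim _ _
  rfl

theorem hasSum_opEntry_mul (hp : p ≠ ⊤) (S T : EllP X p →L[ℂ] EllP X p) (x y : X) :
    HasSum (fun z => opEntry S x z * opEntry T z y) (opEntry (S * T) x y) := by
  classical
  set ξ : EllP X p := T (lp.single p y (1 : ℂ)) with hξ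
  have hs := (lp.hasSum_single hp ξ).mapL ((lp.evalCLM ℂ (fun _ : X => ℂ) p x).comp S)
  have h0 : ∀ z, ((lp.evalCLM ℂ (fun _ : X => ℂ) p x).comp S) (lp.single p z (ξ z)) =
      S (lp.single p z (1 : ℂ)) x * ξ z := by
    intro z
    have e : lp.single p z (ξ z) = ξ z • lp.single (E := fun _ : X => ℂ) p z (1 : ℂ) := by
      rw [← lp.single_smul]
      simp
    rw [e, map_smul, smul_eq_mul, mul_comm]
    rfl
  simp only [h0] at hs
  simp only [opEntry_eq]
  exact hs

theorem norm_opEntry_le (T : EllP X p →L[ℂ] EllP X p) (x y : X) : ‖opEntry T x y‖ ≤ ‖T‖ := by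
  classical
  have hp : 0 < p := zero_lt_one.trans_le Fact.out
  unfold opEntry
  refine (lp.norm_apply_le_norm hp.ne' _ x).trans ((T.le_opNorm _).trans ?_)
  rw [lp.norm_single hp, norm_one, mul_one]

/-- The average of the diagonal entries over a finite set. -/
noncomputable def avgTrace (F : Finset X) : (EllP X p →L[ℂ] EllP X p) →+ ℂ where
  toFun T := (F.card : ℂ)⁻¹ * ∑ x ∈ F, opEntry T x x
  map_zero' := by
    rw [Finset.sum_eq_zero fun x _ => ?_, mul_zero]
    rfl
  map_add' S T := by
    simp only [opEntry_add, Finset.sum_add_distrib, mul_add]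

theorem avgTrace_apply (F : Finset X) (T : EllP X p →L[ℂ] EllP X p) :
    avgTrace F T = (F.card : ℂ)⁻¹ * ∑ x ∈ F, opEntry T x x := rfl

theorem norm_avgTrace_le (F : Finset X) (T : EllP X p →L[ℂ] EllP X p) :
    ‖avgTrace F T‖ ≤ ‖T‖ := by
  rw [avgTrace_apply, norm_mul, norm_inv, Complex.norm_natCast]
  have h : ‖∑ x ∈ F, opEntry T x x‖ ≤ F.card * ‖T‖ := by
    refine (norm_sum_le _ _).trans ((Finset.sum_le_card_nsmul _ _ _
      fun x _ => norm_opEntry_le T x x).trans ?_)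
    rw [nsmul_eq_mul]
  rcases F.card.eq_zero_or_pos with h0 | h0
  · simp [h0]
  · rw [inv_mul_le_iff₀ (by exact_mod_cast h0)]
    exact h

/-- Since `S` has no nonzero entry between `F` and its complement, the diagonal entries of both
products over `F` reduce to the same finite double sum over `F × F`. Nothing is needed of `T`. -/
theorem avgTrace_mul_comm (hp : p ≠ ⊤) (F : Finset X) (S T : EllP X p →L[ℂ] EllP X p)
    (h : ∀ x z, opEntry S x z ≠ 0 → (x ∈ F ↔ z ∈ F)) :
    avgTrace F (S * T) = avgTrace F (T * S) := by
  have h1 : ∀ x ∈ F, opEntry (S * T) x x = ∑ z ∈ F, opEntry S x z * opEntry T z x := by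
    intro x hx
    refine (hasSum_opEntry_mul hp S T x x).unique (hasSum_sum_of_ne_finset_zero fun z hz => ?_)
    rw [mul_eq_zero]
    by_contra! hne
    exact hz ((h x z hne.1).1 hx)
  have h2 : ∀ z ∈ F, opEntry (T * S) z z = ∑ x ∈ F, opEntry T z x * opEntry S x z := by
    intro z hz
    refine (hasSum_opEntry_mul hp T S z z).unique (hasSum_sum_of_ne_finset_zero fun x hx => ?_)
    rw [mul_eq_zero]
    by_contra! hne
    exact hx ((h x z hne.2).2 hz)
  rw [avgTrace_apply, avgTrace_apply, Finset.sum_congr rfl h1, Finset.sum_congr rfl h2,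
    Finset.sum_comm]
  simp only [mul_comm]

end Entries

/-! ### An arithmetic obstruction modulo null sequences. -/

section NullSequences

/-- The space of complex sequences that tend to zero. -/
def nullSequences : Submodule ℂ (ℕ → ℂ) where
  carrier := {u | Tendsto u atTop (𝓝 0)}
  zero_mem' := tendsto_const_nhds
  add_mem' {u v} hu hv := by
    have := Tendsto.add hu hv
    rwa [add_zero] at this
  smul_mem' c u hu := by
    have := Tendsto.const_smul hu c
    rwa [smul_zero] at this

theorem eq_zero_of_zsmul_eq_zero {M : Type*} [AddCommGroup M] [Module ℂ M] {k : ℤ} {γ : M}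
    (hk : k ≠ 0) (h : k • γ = 0) : γ = 0 := by
  rw [← Int.cast_smul_eq_zsmul ℂ] at h
  exact (smul_eq_zero.1 h).resolve_left (by exact_mod_cast hk)

/-- The class of an eventually constant sequence with value `1 / N` for unboundedly many `N` cannot
always be a multiple of a fixed class. -/
theorem not_forall_exists_zsmul (γ : (ℕ → ℂ) ⧸ nullSequences)
    (hγ : ∀ M : ℕ, ∃ N : ℕ, M ≤ N ∧ 0 < N ∧ ∃ u : ℕ → ℂ, (∀ᶠ n in atTop, u n = (N : ℂ)⁻¹) ∧
      ∃ k : ℤ, nullSequences.mkQ u = k • γ) : False := by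
  have key : ∀ M : ℕ, ∃ N : ℕ, M ≤ N ∧ 0 < N ∧ ∃ k : ℤ,
      nullSequences.mkQ (fun _ => 1) = ((N : ℤ) * k) • γ := by
    intro M
    obtain ⟨N, hM, hN, u, hu, k, hk⟩ := hγ M
    refine ⟨N, hM, hN, k, ?_⟩
    rw [mul_smul, ← hk, natCast_zsmul, ← map_nsmul]
    refine (Submodule.Quotient.eq _).2 ?_
    refine Tendsto.congr' (f₁ := fun _ => 0) ?_ tendsto_const_nhds
    filter_upwards [hu] with n hn
    have : (N : ℂ) ≠ 0 := by exact_mod_cast hN.ne'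
    simp [hn, this]
  have hne : nullSequences.mkQ (fun _ => 1) ≠ 0 := by
    intro h
    have h1 : Tendsto (fun _ : ℕ => (1 : ℂ)) atTop (𝓝 0) :=
      (Submodule.Quotient.mk_eq_zero nullSequences).1 h
    exact one_ne_zero (tendsto_nhds_unique tendsto_const_nhds h1)
  obtain ⟨N₀, -, hN₀, k₀, hk₀⟩ := key 0
  have hm : (N₀ : ℤ) * k₀ ≠ 0 := by
    intro h
    rw [h, zero_smul] at hk₀
    exact hne hk₀
  -- The class of the constant sequence 1 is `m • γ` with `m = N₀ * k₀` nonzero. As the quotient is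
  -- torsion free, `m` is unique, so it is divisible by every admissible `N`, including one larger
  -- than `|m|`.
  obtain ⟨N, hN, -, k, hk⟩ := key (((N₀ : ℤ) * k₀).natAbs + 1)
  have heq : (N₀ : ℤ) * k₀ = N * k := by
    by_contra hd
    have h0 : ((N₀ : ℤ) * k₀ - N * k) • γ = 0 := by
      rw [sub_smul, ← hk₀, ← hk, sub_self]
    have := eq_zero_of_zsmul_eq_zero (sub_ne_zero.2 hd) h0
    rw [this, smul_zero] at hk₀
    exact hne hk₀
  have hdvd : N ∣ ((N₀ : ℤ) * k₀).natAbs := by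
    rw [heq, Int.natAbs_mul, Int.natAbs_natCast]
    exact Nat.dvd_mul_right _ _
  have := Nat.le_of_dvd (Int.natAbs_pos.2 hm) hdvd
  omega

end NullSequences

/-! ### Exhaustion by finite subgroups. -/

section Chain

variable {G : Type*} [Group G] [Countable G]

theorem exists_chain_finite_subgroup (hG : IsLocallyFiniteGroup G) : ∃ H : ℕ → Subgroup G,
    Monotone H ∧ (∀ n, Finite (H n)) ∧ ∀ x, ∃ n, x ∈ H n := by
  obtain ⟨e, he⟩ := exists_surjective_nat G
  refine ⟨fun n => Subgroup.closure (e '' Set.Iic n), ?_, ?_, ?_⟩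
  · exact fun m n h => Subgroup.closure_mono (Set.image_mono (Set.Iic_subset_Iic.2 h))
  · exact fun n => hG _ ⟨((Set.finite_Iic n).image e).toFinset, by simp⟩
  · intro x
    obtain ⟨n, rfl⟩ := he x
    exact ⟨n, Subgroup.subset_closure ⟨n, Set.self_mem_Iic, rfl⟩⟩

omit [Countable G] in
theorem Monotone.exists_subset_subgroup {H : ℕ → Subgroup G} (hH : Monotone H)
    (hu : ∀ x, ∃ n, x ∈ H n) {s : Set G} (hs : s.Finite) : ∃ n, s ⊆ H n := by
  induction s, hs using Set.Finite.induction_on with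
  | empty => exact ⟨0, Set.empty_subset _⟩
  | insert _ _ ih =>
    obtain ⟨n, hn⟩ := ih
    obtain ⟨m, hm⟩ := hu ‹_›
    exact ⟨max m n, Set.insert_subset (hH (le_max_left _ _) hm)
      (hn.trans (hH (le_max_right _ _)))⟩

omit [Countable G] in
theorem Monotone.exists_le_card_subgroup [Infinite G] {H : ℕ → Subgroup G} (hH : Monotone H)
    (hf : ∀ n, Finite (H n)) (hu : ∀ x, ∃ n, x ∈ H n) (M : ℕ) : ∃ n, M ≤ Nat.card (H n) := by
  obtain ⟨s, hs⟩ := Infinite.exists_subset_card_eq G M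
  obtain ⟨n, hn⟩ := hH.exists_subset_subgroup hu s.finite_toSet
  have := hf n
  refine ⟨n, ?_⟩
  rw [← hs, ← Set.ncard_coe_finset]
  exact Set.ncard_le_ncard hn (Set.toFinite _)

end Chain

/-! ### The trace along a chain, and projections of small trace. -/

section GroupTrace

variable {G : Type*} [Group G] [MetricSpace G] [IsIsometricSMul G G] [Countable G] [ProperSpace G]
  {p : ℝ≥0∞} [Fact (1 ≤ p)] (H : ℕ → Subgroup G) [∀ n, Finite (H n)]

/-- The elements of the `n`-th group of a chain of finite subgroups. -/
noncomputable def chainFinset (n : ℕ) : Finset G := (Set.toFinite (H n : Set G)).toFinset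

omit [MetricSpace G] [IsIsometricSMul G G] [Countable G] [ProperSpace G] in
theorem mem_chainFinset {n : ℕ} {x : G} : x ∈ chainFinset H n ↔ x ∈ H n := by
  simp [chainFinset]

omit [MetricSpace G] [IsIsometricSMul G G] [Countable G] [ProperSpace G] in
theorem card_chainFinset (n : ℕ) : (chainFinset H n).card = Nat.card (H n) :=
  (Set.ncard_eq_toFinset_card _ _).symm

/-- Approximate `S` by `S'` of propagation at most `R`. Once `H n` contains the ball of radius `R`
about 1, the entries of `S'` respect left cosets of `H n`, so its commutator with `T` averages to
zero. The error is at most `2 ‖S - S'‖ ‖T‖`. -/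
theorem tendsto_avgTrace_commutator (hH : Monotone H) (hu : ∀ x, ∃ n, x ∈ H n) (hp : p ≠ ⊤)
    {S : EllP G p →L[ℂ] EllP G p} (hS : S ∈ uniformRoeAlgebra G p hp)
    (T : EllP G p →L[ℂ] EllP G p) :
    Tendsto (fun n => avgTrace (chainFinset H n) (S * T - T * S)) atTop (𝓝 0) := by
  rw [Metric.tendsto_atTop]
  intro ε hε
  -- The `+ 1` covers the case `T = 0`.
  have hδ : 0 < ε / (2 * ‖T‖ + 1) := by positivity
  obtain ⟨S', hS', hd⟩ := Metric.mem_closure_iff.1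
    (show S ∈ closure (finitePropagationAlgebra G p hp : Set _) from hS) _ hδ
  obtain ⟨R, _, hR⟩ := (mem_finitePropagationAlgebra_iff hp).1 hS'
  obtain ⟨n₀, hn₀⟩ := hH.exists_subset_subgroup hu (finite_closedBall (1 : G) R)
  refine ⟨n₀, fun n hn => ?_⟩
  have h0 : avgTrace (chainFinset H n) (S' * T) = avgTrace (chainFinset H n) (T * S') := by
    refine avgTrace_mul_comm hp _ _ _ fun x z hxz => ?_
    rw [mem_chainFinset, mem_chainFinset]
    have hmem : x⁻¹ * z ∈ H n := by
      refine hH hn (hn₀ ?_)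
      rw [Metric.mem_closedBall, dist_comm, dist_one_inv_mul]
      exact hR x z hxz
    constructor
    · intro hx
      have := (H n).mul_mem hx hmem
      rwa [mul_inv_cancel_left] at this
    · intro hz
      have := (H n).mul_mem hz ((H n).inv_mem hmem)
      simpa using this
  have h1 : S * T - T * S = (S - S') * T - T * (S - S') + (S' * T - T * S') := by
    noncomm_ring
  rw [dist_zero_right, h1, map_add, map_sub _ (S' * T), h0, sub_self, add_zero]
  refine (norm_avgTrace_le _ _).trans_lt ?_
  rw [dist_eq_norm] at hd
  calc ‖(S - S') * T - T * (S - S')‖ ≤ ‖(S - S') * T‖ + ‖T * (S - S')‖ := norm_sub_le _ _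
    _ ≤ ‖S - S'‖ * ‖T‖ + ‖T‖ * ‖S - S'‖ := add_le_add (norm_mul_le _ _) (norm_mul_le _ _)
    _ ≤ ‖S - S'‖ * (2 * ‖T‖ + 1) := by nlinarith [norm_nonneg (S - S')]
    _ < ε := by rwa [lt_div_iff₀ (by positivity)] at hd

/-- The trace on the uniform Roe algebra given by the averages of the diagonal entries along a
chain of finite subgroups, up to null sequences. -/
noncomputable def chainTrace (p : ℝ≥0∞) [Fact (1 ≤ p)] (hp : p ≠ ⊤) :
    uniformRoeAlgebra G p hp →+ (ℕ → ℂ) ⧸ nullSequences :=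
  (nullSequences.mkQ.toAddMonoidHom.comp
    (AddMonoidHom.pi fun n => avgTrace (chainFinset H n))).comp
    (uniformRoeAlgebra G p hp).val.toRingHom.toAddMonoidHom

omit [IsIsometricSMul G G] [Countable G] [ProperSpace G] in
theorem chainTrace_apply (hp : p ≠ ⊤) (a : uniformRoeAlgebra G p hp) :
    chainTrace H p hp a = nullSequences.mkQ fun n => avgTrace (chainFinset H n) a.1 := rfl

theorem chainTrace_mul_comm (hH : Monotone H) (hu : ∀ x, ∃ n, x ∈ H n) (hp : p ≠ ⊤)
    (a b : uniformRoeAlgebra G p hp) : chainTrace H p hp (a * b) = chainTrace H p hp (b * a) := by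
  rw [chainTrace_apply, chainTrace_apply]
  refine (Submodule.Quotient.eq _).2 ?_
  refine Tendsto.congr (fun n => ?_) (tendsto_avgTrace_commutator H hH hu hp a.2 b.1)
  exact map_sub (avgTrace (chainFinset H n)) (a.1 * b.1) (b.1 * a.1)

/-- The projection onto the functions supported on a set. -/
noncomputable def indicatorOp (hp : p ≠ ⊤) (D : Set G) [DecidablePred (· ∈ D)] :
    uniformRoeAlgebra G p hp :=
  ⟨translationOp hp (PEquiv.ofSet D), translationOp_mem_uniformRoeAlgebra hp _ one_pos
    fun x y hxy => by
      rw [(PEquiv.ofSet_eq_some_iff.1 hxy).1, dist_self]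
      exact zero_le_one⟩

omit [IsIsometricSMul G G] [Countable G] [ProperSpace G] [Group G] in
theorem isIdempotentElem_indicatorOp (hp : p ≠ ⊤) (D : Set G) [DecidablePred (· ∈ D)] :
    IsIdempotentElem (indicatorOp (p := p) hp D) := by
  refine Subtype.ext ?_
  refine (translationOp_comp hp (PEquiv.ofSet D) (PEquiv.ofSet D)).trans ?_
  congr 1
  have := PEquiv.self_trans_symm (PEquiv.ofSet D)
  rw [PEquiv.ofSet_symm] at this
  rw [this]
  ext x : 1
  by_cases h : x ∈ D <;> simp [PEquiv.ofSet, h]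

omit [IsIsometricSMul G G] [Countable G] [ProperSpace G] [Group G] in
theorem opEntry_indicatorOp (hp : p ≠ ⊤) (D : Set G) [DecidablePred (· ∈ D)] (x : G) :
    opEntry (indicatorOp (p := p) hp D).1 x x = if x ∈ D then 1 else 0 := by
  classical
  have h : opEntry (indicatorOp (p := p) hp D).1 x x =
      (PEquiv.ofSet D x).elim 0 (lp.single (E := fun _ : G => ℂ) p x (1 : ℂ)) := by
    unfold opEntry
    refine (translationOp_apply hp _ _ _).trans ?_
    congr!
  rw [h]
  by_cases hx : x ∈ D
  · rw [if_pos hx, PEquiv.ofSet_eq_some_self_iff.2 hx]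
    exact lp.single_apply_self (E := fun _ : G => ℂ) p x (1 : ℂ)
  · rw [if_neg hx]
    have : PEquiv.ofSet D x = none := by simp [PEquiv.ofSet, hx]
    rw [this]
    rfl

-- For `n ≥ k`, `H n` is a union of left cosets of `H k`, and `D` meets each of them once.
omit [IsIsometricSMul G G] [Countable G] [ProperSpace G] [MetricSpace G] in
theorem card_filter_mul_card (hH : Monotone H) {k n : ℕ} (hkn : k ≤ n) {D : Set G}
    [DecidablePred (· ∈ D)] (hD : Subgroup.IsComplement D (H k : Set G)) :
    ((chainFinset H n).filter (· ∈ D)).card * (chainFinset H k).card =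
      (chainFinset H n).card := by
  rw [← Finset.card_product]
  refine Finset.card_bij (fun x _ => x.1 * x.2) ?_ ?_ ?_
  · intro x hx
    rw [Finset.mem_product, Finset.mem_filter, mem_chainFinset, mem_chainFinset] at hx
    exact (mem_chainFinset H).2 ((H n).mul_mem hx.1.1 (hH hkn hx.2))
  · intro x hx y hy hxy
    rw [Finset.mem_product, Finset.mem_filter, mem_chainFinset, mem_chainFinset] at hx hy
    have := @hD.1 ⟨⟨x.1, hx.1.2⟩, ⟨x.2, hx.2⟩⟩ ⟨⟨y.1, hy.1.2⟩, ⟨y.2, hy.2⟩⟩ hxy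
    simp only [Prod.mk.injEq, Subtype.mk.injEq] at this
    exact Prod.ext this.1 this.2
  · intro x hx
    obtain ⟨⟨d, h⟩, rfl⟩ := hD.2 x
    rw [mem_chainFinset] at hx
    refine ⟨(d.1, h.1), ?_, rfl⟩
    rw [Finset.mem_product, Finset.mem_filter, mem_chainFinset, mem_chainFinset]
    refine ⟨⟨?_, d.2⟩, h.2⟩
    have := (H n).mul_mem hx ((H n).inv_mem (hH hkn h.2))
    simpa using this

theorem not_exists_forall_kZero_eq_zsmul [Infinite G] (hG : IsLocallyFiniteGroup G) (hp : p ≠ ⊤) :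
    ¬ ∃ g : KZero (uniformRoeAlgebra G p hp), ∀ x, ∃ k : ℤ, x = k • g := by
  classical
  intro h
  obtain ⟨H, hH, hf, hu⟩ := exists_chain_finite_subgroup hG
  obtain ⟨γ, hγ⟩ := KZero.exists_trace_eq_zsmul (chainTrace H p hp)
    (chainTrace_mul_comm H hH hu hp) h
  refine not_forall_exists_zsmul γ fun M => ?_
  obtain ⟨k, hk⟩ := hH.exists_le_card_subgroup hf hu M
  obtain ⟨D, hD, -⟩ := (H k).exists_isComplement_left 1
  -- The indicator of the transversal `D` has average exactly `1 / |H k|` over `H n` for every `n ≥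
  -- k`.
  refine ⟨Nat.card (H k), hk, Nat.card_pos,
    fun n => avgTrace (chainFinset H n) (indicatorOp (p := p) hp D).1, ?_, ?_⟩
  · filter_upwards [eventually_ge_atTop k] with n hn
    have hcard := card_filter_mul_card H hH hn hD
    rw [avgTrace_apply, Finset.sum_congr rfl fun x _ => opEntry_indicatorOp hp D x,
      ← Finset.sum_filter, Finset.sum_const, nsmul_eq_mul, mul_one, ← hcard, ← card_chainFinset]
    have hn0 : (chainFinset H n).card ≠ 0 := by
      rw [card_chainFinset]
      exact Nat.card_pos.ne'
    rw [← hcard] at hn0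
    have h1 := left_ne_zero_of_mul hn0
    have h2 := right_ne_zero_of_mul hn0
    push_cast
    field_simp
  · obtain ⟨m, hm⟩ := hγ _ (isIdempotentElem_indicatorOp hp D)
    exact ⟨m, (chainTrace_apply H hp _).symm.trans hm⟩

end GroupTrace

end RoeTrace

/-! ### Coarse classification of infinite locally finite groups -/

section Balanced

/-- A finite set can be distributed evenly. -/
theorem exists_map_card_fiber {α β : Type*} [Finite α] [Finite β] {m M : ℕ}
    (hm : m * Nat.card β ≤ Nat.card α) (hM : Nat.card α ≤ M * Nat.card β) :
    ∃ f : α → β, ∀ b, m ≤ Nat.card {a // f a = b} ∧ Nat.card {a // f a = b} ≤ M := by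
  rcases isEmpty_or_nonempty β with hβ | hβ
  · rw [Nat.card_of_isEmpty (α := β), mul_zero, nonpos_iff_eq_zero] at hM
    have : IsEmpty α := (Finite.card_eq_zero_iff).1 hM
    exact ⟨isEmptyElim, isEmptyElim⟩
  have hb : 0 < Nat.card β := Nat.card_pos
  let eα := Finite.equivFin α
  let eβ := Finite.equivFin β
  -- After numbering both sets, reduction modulo `|β|` makes the fibre sizes differ by at most one.
  refine ⟨fun a => eβ.symm ⟨eα a % Nat.card β, Nat.mod_lt _ hb⟩, fun b => ?_⟩
  have hcard : Nat.card {a // eβ.symm ⟨eα a % Nat.card β, Nat.mod_lt _ hb⟩ = b} =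
      (Nat.card α).count (· ≡ (eβ b : ℕ) [MOD Nat.card β]) := by
    have hiff : ∀ a, eβ.symm ⟨eα a % Nat.card β, Nat.mod_lt _ hb⟩ = b ↔
        (eα a : ℕ) ≡ eβ b [MOD Nat.card β] := by
      intro a
      rw [Equiv.symm_apply_eq, Fin.ext_iff, Nat.ModEq, Nat.mod_eq_of_lt (eβ b).2]
    rw [Nat.count_eq_card_filter_range, ← Nat.subtype_card _ fun x => Finset.mem_filter]
    refine Nat.card_congr ⟨fun a => ⟨eα a.1, Finset.mem_range.2 (eα a.1).2, (hiff _).1 a.2⟩,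
      fun x => ⟨eα.symm ⟨x.1, Finset.mem_range.1 x.2.1⟩, (hiff _).2 ?_⟩, fun a => ?_, fun x => ?_⟩
    · rw [Equiv.apply_symm_apply]
      exact x.2.2
    · simp
    · simp
  rw [hcard, Nat.count_modEq_card _ hb]
  constructor
  · exact ((Nat.le_div_iff_mul_le hb).2 hm).trans (Nat.le_add_right _ _)
  · have h1 := Nat.div_add_mod (Nat.card α) (Nat.card β)
    have h2 := Nat.mod_lt (Nat.card α) hb
    split_ifs with h
    -- A fibre gets the extra element only if `|β|` does not divide `|α|`, which makes the upper
    -- bound `hM` strict.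
    · rw [Nat.add_one_le_iff, Nat.div_lt_iff_lt_mul hb]
      refine lt_of_le_of_ne hM fun he => ?_
      rw [he, Nat.mul_mod_left] at h
      exact Nat.not_lt_zero _ h
    · rw [add_zero]
      exact Nat.div_le_of_le_mul (by rwa [mul_comm])

/-- Two-step distribution: the fibres of `π` are distributed over the fibres of `τ`. -/
theorem exists_refinement {C A L : Type*} [Finite C] [Finite A] [Finite L] (π : C → A)
    {q u v s : ℕ} (hπ : ∀ a, Nat.card {c // π c = a} = q)
    (hq : ∀ n, u ≤ n → n ≤ v → s * n ≤ q ∧ q ≤ (s + 1) * n)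
    (hu : u * Nat.card A ≤ Nat.card L) (hv : Nat.card L ≤ v * Nat.card A) :
    ∃ (σ : C → L) (τ : L → A), (∀ c, τ (σ c) = π c) ∧
      ∀ l, s ≤ Nat.card {c // σ c = l} ∧ Nat.card {c // σ c = l} ≤ s + 1 := by
  obtain ⟨τ, hτ⟩ := exists_map_card_fiber hu hv
  have : ∀ a, ∃ f : {c // π c = a} → {l // τ l = a}, ∀ b, s ≤ Nat.card {c // f c = b} ∧
      Nat.card {c // f c = b} ≤ s + 1 := fun a => by
    have h := hq _ (hτ a).1 (hτ a).2
    rw [← hπ a] at h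
    exact exists_map_card_fiber h.1 h.2
  choose f hf using this
  have hf' : ∀ a c (h : π c = a), (f a ⟨c, h⟩).1 = (f (π c) ⟨c, rfl⟩).1 := by
    rintro _ c rfl
    rfl
  refine ⟨fun c => (f (π c) ⟨c, rfl⟩).1, τ, fun c => (f (π c) ⟨c, rfl⟩).2, fun l => ?_⟩
  have hcard : Nat.card {c // (f (π c) ⟨c, rfl⟩).1 = l} =
      Nat.card {c // f (τ l) c = ⟨l, rfl⟩} := by
    refine Nat.card_congr ⟨fun c => ⟨⟨c.1, ?_⟩, Subtype.ext ?_⟩, fun c => ⟨c.1.1, ?_⟩,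
      fun c => rfl, fun c => rfl⟩
    · exact (f (π c.1) ⟨c.1, rfl⟩).2.symm.trans (congrArg τ c.2)
    · exact (hf' _ _ _).trans c.2
    · exact (hf' _ _ c.1.2).symm.trans (congrArg Subtype.val c.2)
  rw [hcard]
  exact hf _ _

end Balanced

/-! ### Numbers of cosets that can be distributed. -/

section Numerics

/-- The admissible `n` are those between `q / (s + 1)` and `q / s`. The bound on `q` ensures `u < v`
for the integer endpoints. The intervals from `(s' + 1) * u` to `s' * v` then cover all large `r`.
-/
theorem exists_admissible (s : ℕ) (hs : 0 < s) {q : ℕ} (hq : 2 * s * (s + 1) ≤ q) :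
    ∃ u v : ℕ, (∀ n, u ≤ n → n ≤ v → s * n ≤ q ∧ q ≤ (s + 1) * n) ∧
      ∃ R, ∀ r, R ≤ r → ∃ s', 0 < s' ∧ (s' + 1) * u ≤ r ∧ r ≤ s' * v := by
  have ht := Nat.div_mul_le_self q (s + 1)
  have ht' : 2 * s ≤ q / (s + 1) := (Nat.le_div_iff_mul_le (Nat.succ_pos s)).2 hq
  set t := q / (s + 1) with htdef
  have huv : t + 2 ≤ q / s := by
    rw [Nat.le_div_iff_mul_le hs]
    nlinarith
  refine ⟨t + 1, q / s, fun n hn hn' => ⟨?_, ?_⟩, 2 * (t + 1) * (q / s), fun r hr =>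
    ⟨r / (q / s) + 1, Nat.succ_pos _, ?_, ?_⟩⟩
  · rw [mul_comm]
    exact (Nat.mul_le_mul_right _ hn').trans (Nat.div_mul_le_self _ _)
  · have h1 : q < (s + 1) * (t + 1) := Nat.lt_mul_div_succ q (Nat.succ_pos s)
    exact h1.le.trans (Nat.mul_le_mul_left _ hn)
  -- With `v = q / s`, `u = t + 1 ≤ v - 1` and `r / v ≥ 2 * u`, one gets `(r / v + 2) * u ≤ (r / v)
  -- * v - r / v + 2 * u ≤ r`.
  · have hv : 0 < q / s := by omega
    have h1 := Nat.div_mul_le_self r (q / s)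
    have h2 : 2 * (t + 1) ≤ r / (q / s) := (Nat.le_div_iff_mul_le hv).2 hr
    nlinarith
  · have hv : 0 < q / s := by omega
    have := Nat.lt_mul_div_succ r hv
    rw [mul_comm]
    exact this.le

end Numerics

/-! ### Interleaved chains and maps compatible with them. -/

section Tower

theorem card_fiber_quotientMapOfLE {G : Type*} [Group G] {s t : Subgroup G} (h : s ≤ t)
    (a : G ⧸ t) : Nat.card {c : G ⧸ s // Subgroup.quotientMapOfLE h c = a} = s.relIndex t := by
  let e := Subgroup.quotientEquivProdOfLE h
  have he : ∀ c, (e c).1 = Subgroup.quotientMapOfLE h c := fun _ => rfl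
  refine Nat.card_congr ⟨fun c => (e c.1).2, fun d => ⟨e.symm (a, d), ?_⟩, fun c => ?_, fun d => ?_⟩
  · rw [← he, Equiv.apply_symm_apply]
  · refine Subtype.ext ?_
    change e.symm (a, (e c.1).2) = c.1
    rw [Equiv.symm_apply_eq]
    refine Prod.ext ?_ rfl
    rw [he, c.2]
  · simp

theorem exists_finite_subgroup_of_infinite {G : Type*} [Group G] [Infinite G]
    (hG : IsLocallyFiniteGroup G) (H : Subgroup G) [Finite H] (x : G) (Q : ℕ) :
    ∃ H' : Subgroup G, Finite H' ∧ H ≤ H' ∧ x ∈ H' ∧ Q ≤ H.relIndex H' := by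
  -- A subgroup containing `Q * |H|` elements has index at least `Q` over `H`.
  obtain ⟨F, hF⟩ := Infinite.exists_subset_card_eq G (Q * Nat.card H)
  have hs : ((H : Set G) ∪ {x} ∪ F).Finite :=
    ((Set.toFinite _).union (Set.finite_singleton x)).union F.finite_toSet
  obtain ⟨H', hfin, hH'⟩ := exists_finite_subgroup hG hs
  have hle : H ≤ H' := fun y hy => hH' (Or.inl (Or.inl hy))
  refine ⟨H', hfin, hle, hH' (Or.inl (Or.inr rfl)), ?_⟩
  have h1 := Subgroup.relIndex_mul_relIndex ⊥ H H' bot_le hle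
  rw [Subgroup.relIndex_bot_left, Subgroup.relIndex_bot_left] at h1
  have h2 : Q * Nat.card H ≤ Nat.card H' := by
    rw [← hF, ← Set.ncard_coe_finset]
    exact Set.ncard_le_ncard (fun y hy => hH' (Or.inr hy)) (Set.toFinite _)
  rw [← h1, mul_comm] at h2
  exact Nat.le_of_mul_le_mul_left h2 Nat.card_pos

variable {Γ Λ : Type*} [Group Γ] [Group Λ]

/-- Interleaved chains of finite subgroups, together with the numbers of cosets that the coarse
equivalence between the two groups matches at each stage. -/
structure InterleavedChains (H : ℕ → Subgroup Γ) (K : ℕ → Subgroup Λ) (s : ℕ → ℕ) : Prop where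
  le_left : ∀ k, H k ≤ H (k + 1)
  le_right : ∀ k, K k ≤ K (k + 1)
  finite_left : ∀ k, Finite (H k)
  finite_right : ∀ k, Finite (K k)
  exhausts_left : ∀ x, ∃ k, x ∈ H k
  exhausts_right : ∀ y, ∃ k, y ∈ K k
  bot_right : K 0 = ⊥
  size_zero : s 0 = 1
  size_pos : ∀ k, 0 < s k
  admissible : ∀ k, ∃ u v : ℕ, (∀ n, u ≤ n → n ≤ v →
    s k * n ≤ (H k).relIndex (H (k + 1)) ∧ (H k).relIndex (H (k + 1)) ≤ (s k + 1) * n) ∧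
    (s (k + 1) + 1) * u ≤ (K k).relIndex (K (k + 1)) ∧
    (K k).relIndex (K (k + 1)) ≤ s (k + 1) * v

theorem exists_interleavedChains [Countable Γ] [Countable Λ] [Infinite Γ] [Infinite Λ]
    (hΓ : IsLocallyFiniteGroup Γ) (hΛ : IsLocallyFiniteGroup Λ) :
    ∃ (H : ℕ → Subgroup Γ) (K : ℕ → Subgroup Λ) (s : ℕ → ℕ), InterleavedChains H K s := by
  obtain ⟨x, hx⟩ := exists_surjective_nat Γ
  obtain ⟨y, hy⟩ := exists_surjective_nat Λ
  let State := {σ : Subgroup Γ × Subgroup Λ × ℕ // Finite σ.1 ∧ Finite σ.2.1 ∧ 0 < σ.2.2}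
  have step : ∀ (k : ℕ) (σ : State), ∃ σ' : State, σ.1.1 ≤ σ'.1.1 ∧ σ.1.2.1 ≤ σ'.1.2.1 ∧
      x k ∈ σ'.1.1 ∧ y k ∈ σ'.1.2.1 ∧ ∃ u v : ℕ, (∀ n, u ≤ n → n ≤ v →
        σ.1.2.2 * n ≤ σ.1.1.relIndex σ'.1.1 ∧ σ.1.1.relIndex σ'.1.1 ≤ (σ.1.2.2 + 1) * n) ∧
        (σ'.1.2.2 + 1) * u ≤ σ.1.2.1.relIndex σ'.1.2.1 ∧
        σ.1.2.1.relIndex σ'.1.2.1 ≤ σ'.1.2.2 * v := by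
    rintro k ⟨⟨H, K, s⟩, hH, hK, hs⟩
    -- The order of choices matters: the index on the left fixes `u`, `v` and the threshold `R`, the
    -- index on the right must exceed `R`, and only then is the next size `s'` determined.
    obtain ⟨H', hH', hle, hxk, hq⟩ :=
      exists_finite_subgroup_of_infinite hΓ H (x k) (2 * s * (s + 1))
    obtain ⟨u, v, h1, R, h2⟩ := exists_admissible s hs hq
    obtain ⟨K', hK', hle', hyk, hr⟩ := exists_finite_subgroup_of_infinite hΛ K (y k) R
    obtain ⟨s', hs', h3⟩ := h2 _ hr
    exact ⟨⟨⟨H', K', s'⟩, hH', hK', hs'⟩, hle, hle', hxk, hyk, u, v, h1, h3⟩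
  choose next hnext using step
  let σ : ℕ → State := fun k => Nat.rec ⟨⟨⊥, ⊥, 1⟩, inferInstance, inferInstance, one_pos⟩ next k
  have hσ : ∀ k, σ (k + 1) = next k (σ k) := fun _ => rfl
  refine ⟨fun k => (σ k).1.1, fun k => (σ k).1.2.1, fun k => (σ k).1.2.2,
    fun k => (hnext k (σ k)).1, fun k => (hnext k (σ k)).2.1, fun k => (σ k).2.1,
    fun k => (σ k).2.2.1, fun z => ?_, fun z => ?_, rfl, rfl, fun k => (σ k).2.2.2,
    fun k => (hnext k (σ k)).2.2.2.2⟩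
  · obtain ⟨k, rfl⟩ := hx z
    exact ⟨k + 1, (hnext k (σ k)).2.2.1⟩
  · obtain ⟨k, rfl⟩ := hy z
    exact ⟨k + 1, (hnext k (σ k)).2.2.2.1⟩

/-- A map between finite unions of cosets that is compatible with the chains of subgroups up to
level `k`, in both directions. -/
structure MatchesChains (H : ℕ → Subgroup Γ) (K : ℕ → Subgroup Λ) (k : ℕ) (A : Set (Γ ⧸ H k))
    (b : Λ ⧸ K k) (φ : Γ → Λ) : Prop where
  mapsTo : ∀ x : Γ, (x : Γ ⧸ H k) ∈ A → (φ x : Λ ⧸ K k) = b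
  expansive : ∀ i ≤ k, ∀ x x' : Γ, (x : Γ ⧸ H k) ∈ A → (x' : Γ ⧸ H k) ∈ A →
    x⁻¹ * x' ∈ H i → (φ x)⁻¹ * φ x' ∈ K i
  proper : ∀ i < k, ∀ x x' : Γ, (x : Γ ⧸ H k) ∈ A → (x' : Γ ⧸ H k) ∈ A →
    (φ x)⁻¹ * φ x' ∈ K i → x⁻¹ * x' ∈ H (i + 1)
  surj : ∀ y : Λ, (y : Λ ⧸ K k) = b → ∃ x : Γ, (x : Γ ⧸ H k) ∈ A ∧ φ x = y

/-- Induction on the level. The cosets of `K k` inside `b` are shared out among the cosets in `A`.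
Inside each coset of `A`, its cosets of `H k` are then shared out among the cosets of `K k` it
received, `s k` or `s k + 1` to each. The maps given by induction on these smaller pieces are glued.
-/
theorem InterleavedChains.exists_matchesChains {H : ℕ → Subgroup Γ} {K : ℕ → Subgroup Λ}
    {s : ℕ → ℕ} (h : InterleavedChains H K s) (k : ℕ) : ∀ (A : Set (Γ ⧸ H k)) (b : Λ ⧸ K k),
      A.Finite → s k ≤ Nat.card A → Nat.card A ≤ s k + 1 → ∃ φ, MatchesChains H K k A b φ := by
  have hH : Monotone H := monotone_nat_of_le_succ h.le_left
  have hK : Monotone K := monotone_nat_of_le_succ h.le_right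
  induction k with
  | zero =>
    intro A b _ hA _
    obtain ⟨y, rfl⟩ := QuotientGroup.mk_surjective b
    rw [h.size_zero] at hA
    have hne : Nonempty A := (Nat.card_pos_iff.1 hA).1
    obtain ⟨⟨a, ha⟩⟩ := hne
    obtain ⟨x, rfl⟩ := QuotientGroup.mk_surjective a
    refine ⟨fun _ => y, fun _ _ => rfl, fun i _ _ _ _ _ _ => ?_,
      fun i hi => absurd hi (Nat.not_lt_zero i), fun y' hy' => ⟨x, ha, ?_⟩⟩
    · rw [inv_mul_cancel]
      exact (K i).one_mem
    · rw [QuotientGroup.eq, h.bot_right, Subgroup.mem_bot] at hy'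
      exact (inv_mul_eq_one.1 hy').symm
  | succ k ih =>
    intro A b hAfin hA hA'
    have := hAfin.to_subtype
    have hAne : Nonempty A := (Nat.card_pos_iff.1 ((h.size_pos (k + 1)).trans_le hA)).1
    have hKne : (K k).relIndex (K (k + 1)) ≠ 0 := by
      have := h.finite_right (k + 1)
      exact ((K k).subgroupOf (K (k + 1))).index_ne_zero_of_finite
    have hHne : (H k).relIndex (H (k + 1)) ≠ 0 := by
      have := h.finite_left (k + 1)
      exact ((H k).subgroupOf (H (k + 1))).index_ne_zero_of_finite
    let C := {c : Γ ⧸ H k // Subgroup.quotientMapOfLE (h.le_left k) c ∈ A}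
    let L := {l : Λ ⧸ K k // Subgroup.quotientMapOfLE (h.le_right k) l = b}
    let π : C → A := fun c => ⟨_, c.2⟩
    have hL : Nat.card L = (K k).relIndex (K (k + 1)) := card_fiber_quotientMapOfLE _ _
    have hLfin : Finite L := Nat.finite_of_card_ne_zero (hL ▸ hKne)
    have hπ : ∀ a, Nat.card {c // π c = a} = (H k).relIndex (H (k + 1)) := by
      intro a
      rw [← card_fiber_quotientMapOfLE (h.le_left k) a.1]
      exact Nat.card_congr ⟨fun c => ⟨c.1.1, congrArg Subtype.val c.2⟩,
        fun c => ⟨⟨c.1, c.2.symm.subst (motive := (· ∈ A)) a.2⟩, Subtype.ext c.2⟩, fun _ => rfl, fun _ => rfl⟩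
    have hCfin : Finite C := by
      have hf : ∀ a, Finite {c // π c = a} := fun a =>
        Nat.finite_of_card_ne_zero ((hπ a).trans_ne hHne)
      exact Finite.of_equiv _ (Equiv.sigmaFiberEquiv π)
    obtain ⟨u, v, hq, hu, hv⟩ := h.admissible k
    -- `σ` assigns to a coset of `H k` its target coset of `K k`, and `τ` records which coset of `H
    -- (k + 1)` owns that target.
    obtain ⟨σ, τ, hστ, hσ⟩ := exists_refinement (L := L) π hπ hq
      (by
        rw [hL, mul_comm]
        exact (Nat.mul_le_mul_right u hA').trans hu)
      (by
        rw [hL, mul_comm]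
        exact hv.trans (Nat.mul_le_mul_right v hA))
    let P : L → Set (Γ ⧸ H k) := fun l => {c | ∃ hc, σ ⟨c, hc⟩ = l}
    have hP : ∀ l, Nat.card (P l) = Nat.card {c // σ c = l} := fun l =>
      Nat.card_congr ⟨fun c => ⟨⟨c.1, c.2.choose⟩, c.2.choose_spec⟩,
        fun c => ⟨c.1.1, c.1.2, c.2⟩, fun _ => rfl, fun _ => rfl⟩
    have hex : ∀ l : L, ∃ φ, MatchesChains H K k (P l) l.1 φ := fun l => by
      refine ih (P l) l.1 ?_ ((hσ l).1.trans_eq (hP l).symm) ((hP l).trans_le (hσ l).2)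
      refine Set.Finite.subset (Set.finite_range fun c : C => c.1) ?_
      rintro c ⟨hc, _⟩
      exact ⟨⟨c, hc⟩, rfl⟩
    choose φ hφ using hex
    classical
    have hmem : ∀ (x : Γ), (x : Γ ⧸ H (k + 1)) ∈ A →
        Subgroup.quotientMapOfLE (h.le_left k) (x : Γ ⧸ H k) ∈ A := fun _ hx => hx
    -- The value 1 off the cosets in `A` plays no role.
    let Φ : Γ → Λ := fun x =>
      if hx : (x : Γ ⧸ H (k + 1)) ∈ A then φ (σ ⟨(x : Γ ⧸ H k), hmem x hx⟩) x else 1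
    have hΦ : ∀ (x : Γ) (hx : (x : Γ ⧸ H (k + 1)) ∈ A),
        Φ x = φ (σ ⟨(x : Γ ⧸ H k), hmem x hx⟩) x := fun x hx => dif_pos hx
    have hxP : ∀ (x : Γ) (hx : (x : Γ ⧸ H (k + 1)) ∈ A),
        (x : Γ ⧸ H k) ∈ P (σ ⟨(x : Γ ⧸ H k), hmem x hx⟩) := fun x hx => ⟨hmem x hx, rfl⟩
    have hΦmk : ∀ (x : Γ) (hx : (x : Γ ⧸ H (k + 1)) ∈ A),
        (Φ x : Λ ⧸ K k) = (σ ⟨(x : Γ ⧸ H k), hmem x hx⟩).1 := fun x hx => by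
      rw [hΦ x hx]
      exact (hφ _).mapsTo x (hxP x hx)
    have hmaps : ∀ x : Γ, (x : Γ ⧸ H (k + 1)) ∈ A → (Φ x : Λ ⧸ K (k + 1)) = b := by
      intro x hx
      refine Eq.trans ?_ (σ ⟨(x : Γ ⧸ H k), hmem x hx⟩).2
      rw [← hΦmk x hx]
      rfl
    have hσeq : ∀ (x x' : Γ) (hx : (x : Γ ⧸ H (k + 1)) ∈ A) (hx' : (x' : Γ ⧸ H (k + 1)) ∈ A),
        (Φ x)⁻¹ * Φ x' ∈ K k →
        σ ⟨(x : Γ ⧸ H k), hmem x hx⟩ = σ ⟨(x' : Γ ⧸ H k), hmem x' hx'⟩ := by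
      intro x x' hx hx' hK'
      refine Subtype.ext ?_
      rw [← hΦmk x hx, ← hΦmk x' hx']
      exact QuotientGroup.eq.2 hK'
    refine ⟨Φ, hmaps, ?_, ?_, ?_⟩
    · intro i hi x x' hx hx' hxx'
      rcases hi.lt_or_eq with hi | rfl
      · have hi := Nat.lt_succ_iff.1 hi
        have heq : (x : Γ ⧸ H k) = (x' : Γ ⧸ H k) := QuotientGroup.eq.2 (hH hi hxx')
        have hl : σ ⟨(x : Γ ⧸ H k), hmem x hx⟩ = σ ⟨(x' : Γ ⧸ H k), hmem x' hx'⟩ :=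
          congrArg σ (Subtype.ext heq)
        have hm := hxP x hx
        rw [hΦ x hx, hΦ x' hx', hl]
        rw [hl] at hm
        exact (hφ _).expansive i hi x x' hm (hxP x' hx') hxx'
      · exact QuotientGroup.eq.1 ((hmaps x hx).trans (hmaps x' hx').symm)
    · intro i hi x x' hx hx' hxx'
      have hi := Nat.lt_succ_iff.1 hi
      have hl := hσeq x x' hx hx' (hK hi hxx')
      rcases hi.lt_or_eq with hi | rfl
      · have hm := hxP x hx
        rw [hΦ x hx, hΦ x' hx', hl] at hxx'
        rw [hl] at hm
        exact (hφ _).proper i hi x x' hm (hxP x' hx') hxx'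
      -- At the top level a common target `l` has a single owner `τ l`, so both points lie in the
      -- same coset of `H (i + 1)`. They may lie in different cosets of `H i`, hence the shift of
      -- index in `proper`.
      · have h1 : π ⟨(x : Γ ⧸ H i), hmem x hx⟩ = π ⟨(x' : Γ ⧸ H i), hmem x' hx'⟩ := by
          rw [← hστ, ← hστ, hl]
        exact QuotientGroup.eq.1 (congrArg Subtype.val h1)
    · intro y hy
      obtain ⟨x, ⟨hx, hxl⟩, hxy⟩ := (hφ ⟨(y : Λ ⧸ K k), hy⟩).surj y rfl
      refine ⟨x, hx, ?_⟩
      rw [hΦ x hx]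
      refine Eq.trans ?_ hxy
      rw [← hxl]

end Tower

/-! ### Limit of the finite-level maps, and coarse equivalence of infinite groups. -/

section CoarseClassification

variable {Γ Λ : Type*} [Group Γ] [Group Λ]

/-- On each `H k` there is a map fixing the identity that is compatible with the chains. -/
theorem InterleavedChains.exists_pointed_map [Infinite Γ] {H : ℕ → Subgroup Γ}
    {K : ℕ → Subgroup Λ} {s : ℕ → ℕ} (h : InterleavedChains H K s) (k : ℕ) :
    ∃ ψ : Γ → Λ, ψ 1 = 1 ∧
      (∀ i ≤ k, ∀ x ∈ H k, ∀ x' ∈ H k, x⁻¹ * x' ∈ H i → (ψ x)⁻¹ * ψ x' ∈ K i) ∧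
      (∀ i < k, ∀ x ∈ H k, ∀ x' ∈ H k, (ψ x)⁻¹ * ψ x' ∈ K i → x⁻¹ * x' ∈ H (i + 1)) ∧
      ∀ i < k, ∀ y ∈ K i, ∃ x ∈ H (i + 1), ψ x = y := by
  have hK : Monotone K := monotone_nat_of_le_succ h.le_right
  have hHk := h.finite_left k
  have hinf : Infinite (Γ ⧸ H k) := by
    by_contra hfin
    rw [not_infinite_iff_finite] at hfin
    have : Finite Γ := Finite.of_equiv _ (Subgroup.groupEquivQuotientProdSubgroup (s := H k)).symm
    exact not_finite Γ
  -- Infinitely many cosets of `H k` leave room for `s k` of them including the trivial one. The map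
  -- is afterwards translated so as to fix the identity.
  obtain ⟨F, hF1, hF⟩ := Infinite.exists_superset_card_eq ({((1 : Γ) : Γ ⧸ H k)} : Finset (Γ ⧸ H k))
    (s k) (h.size_pos k)
  have hcard : Nat.card (F : Set (Γ ⧸ H k)) = s k := by
    rw [← hF]
    exact Nat.card_eq_card_toFinset _ |>.trans (by simp)
  obtain ⟨φ, hφ⟩ := h.exists_matchesChains k F ((1 : Λ) : Λ ⧸ K k) F.finite_toSet hcard.ge
    (hcard.trans_le (Nat.le_succ _))
  have h1F : ((1 : Γ) : Γ ⧸ H k) ∈ (F : Set (Γ ⧸ H k)) := hF1 (Finset.mem_singleton_self _)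
  have hmem : ∀ x ∈ H k, (x : Γ ⧸ H k) ∈ (F : Set (Γ ⧸ H k)) := by
    intro x hx
    have : (x : Γ ⧸ H k) = ((1 : Γ) : Γ ⧸ H k) := by
      rw [eq_comm, QuotientGroup.eq]
      simpa using hx
    rw [this]
    exact h1F
  have hφ1 : φ 1 ∈ K k := by
    have := hφ.mapsTo 1 h1F
    rw [eq_comm, QuotientGroup.eq] at this
    simpa using this
  have hcancel : ∀ x x', ((φ 1)⁻¹ * φ x)⁻¹ * ((φ 1)⁻¹ * φ x') = (φ x)⁻¹ * φ x' := by
    intro x x'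
    group
  refine ⟨fun x => (φ 1)⁻¹ * φ x, inv_mul_cancel _, ?_, ?_, ?_⟩
  · intro i hi x hx x' hx' hxx'
    rw [hcancel]
    exact hφ.expansive i hi x x' (hmem x hx) (hmem x' hx') hxx'
  · intro i hi x hx x' hx' hxx'
    rw [hcancel] at hxx'
    exact hφ.proper i hi x x' (hmem x hx) (hmem x' hx') hxx'
  · intro i hi y hy
    obtain ⟨x, hx, hxy⟩ := hφ.surj (φ 1 * y) (by
      rw [eq_comm, QuotientGroup.eq]
      simpa using (K k).mul_mem hφ1 (hK hi.le hy))
    -- Surjectivity only places the preimage in one of the `s k` cosets in `F`. Properness against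
    -- the point 1 forces it into `H (i + 1)`.
    have hx' := hφ.proper i hi 1 x h1F hx (by
      rw [hxy, inv_mul_cancel_left]
      exact hy)
    refine ⟨x, by simpa using hx', ?_⟩
    change (φ 1)⁻¹ * φ x = y
    rw [hxy, inv_mul_cancel_left]

/-- A pointwise limit of the maps of `exists_pointed_map` along an ultrafilter. -/
theorem InterleavedChains.exists_map [Infinite Γ] {H : ℕ → Subgroup Γ}
    {K : ℕ → Subgroup Λ} {s : ℕ → ℕ} (h : InterleavedChains H K s) :
    ∃ f : Γ → Λ, (∀ i x x', x⁻¹ * x' ∈ H i → (f x)⁻¹ * f x' ∈ K i) ∧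
      (∀ i x x', (f x)⁻¹ * f x' ∈ K i → x⁻¹ * x' ∈ H (i + 1)) ∧ Function.Surjective f := by
  have hH : Monotone H := monotone_nat_of_le_succ h.le_left
  choose ψ hψ1 hexp hprop hsurj using h.exists_pointed_map
  let ω : Ultrafilter ℕ := hyperfilter ℕ
  have hω : ∀ n, ∀ᶠ k in ω, n < k := fun n => by
    have : (ω : Filter ℕ) ≤ atTop := Nat.hyperfilter_le_atTop
    exact this (eventually_gt_atTop n)
  have hlim : ∀ x, ∃ y, ∀ᶠ k in ω, ψ k x = y := by
    intro x
    obtain ⟨i, hi⟩ := h.exhausts_left x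
    have := h.finite_right i
    -- The maps for different `k` need not extend one another, but those with `k > i` send `x ∈ H i`
    -- into the finite set `K i`, so the ultrafilter selects one value.
    have hev : ∀ᶠ k in ω, ∃ y ∈ (K i : Set Λ), ψ k x = y := by
      filter_upwards [hω i] with k hk
      refine ⟨_, ?_, rfl⟩
      have := hexp k i hk.le 1 (H k).one_mem x (hH hk.le hi) (by simpa using hi)
      simpa [hψ1] using this
    obtain ⟨y, -, hy⟩ := (Ultrafilter.eventually_exists_mem_iff (Set.toFinite (K i : Set Λ))).1 hev
    exact ⟨y, hy⟩
  choose f hf using hlim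
  have hboth : ∀ x x', ∀ n, ∃ k, n < k ∧ x ∈ H k ∧ x' ∈ H k ∧ ψ k x = f x ∧ ψ k x' = f x' := by
    intro x x' n
    obtain ⟨i, hi⟩ := h.exhausts_left x
    obtain ⟨j, hj⟩ := h.exhausts_left x'
    obtain ⟨k, h1, h2, h3, h4, h5⟩ :=
      ((hω n).and ((hω i).and ((hω j).and ((hf x).and (hf x'))))).exists
    exact ⟨k, h1, hH h2.le hi, hH h3.le hj, h4, h5⟩
  refine ⟨f, ?_, ?_, ?_⟩
  · intro i x x' hxx'
    obtain ⟨k, hk, hx, hx', h1, h2⟩ := hboth x x' i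
    rw [← h1, ← h2]
    exact hexp k i hk.le x hx x' hx' hxx'
  · intro i x x' hxx'
    obtain ⟨k, hk, hx, hx', h1, h2⟩ := hboth x x' i
    rw [← h1, ← h2] at hxx'
    exact hprop k i hk x hx x' hx' hxx'
  · intro y
    obtain ⟨i, hi⟩ := h.exhausts_right y
    have := h.finite_left (i + 1)
    -- Preimages of `y` stay in the finite set `H (i + 1)` independently of `k`, so one of them
    -- survives in the limit.
    have hev : ∀ᶠ k in ω, ∃ x ∈ (H (i + 1) : Set Γ), ψ k x = y := by
      filter_upwards [hω i] with k hk
      exact hsurj k i hk y hi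
    obtain ⟨x, -, hx⟩ :=
      (Ultrafilter.eventually_exists_mem_iff (Set.toFinite (H (i + 1) : Set Γ))).1 hev
    obtain ⟨k, h1, h2⟩ := (hx.and (hf x)).exists
    exact ⟨x, h2.symm.trans h1⟩

variable [Countable Γ] [MetricSpace Γ] [ProperSpace Γ] [IsIsometricSMul Γ Γ]
  [Countable Λ] [MetricSpace Λ] [ProperSpace Λ] [IsIsometricSMul Λ Λ]

/-- Any two infinite countable locally finite groups are coarsely equivalent. -/
theorem coarselyEquivalent_of_infinite [Infinite Γ] [Infinite Λ] (hΓ : IsLocallyFiniteGroup Γ)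
    (hΛ : IsLocallyFiniteGroup Λ) : CoarselyEquivalent Γ Λ := by
  obtain ⟨H, K, s, h⟩ := exists_interleavedChains hΓ hΛ
  have hH : Monotone H := monotone_nat_of_le_succ h.le_left
  have hK : Monotone K := monotone_nat_of_le_succ h.le_right
  obtain ⟨f, hexp, hprop, hsurj⟩ := h.exists_map
  have hHfin : ∀ i, (H i : Set Γ).Finite := fun i => by
    have := h.finite_left i
    exact Set.toFinite _
  have hKfin : ∀ i, (K i : Set Λ).Finite := fun i => by
    have := h.finite_right i
    exact Set.toFinite _
  have hg := Function.rightInverse_surjInv hsurj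
  refine ⟨f, Function.surjInv hsurj, fun R _ => ?_, fun R _ => ?_, ?_, ?_⟩
  · obtain ⟨i, hi⟩ := hH.exists_subset_subgroup h.exhausts_left (finite_closedBall (1 : Γ) R)
    obtain ⟨S, hS, hd⟩ := exists_dist_le_of_finite _ (hKfin i)
    refine ⟨S, hS, fun x x' hxx' => hd _ _ (hexp i x x' (hi ?_))⟩
    rwa [Metric.mem_closedBall, dist_comm, dist_one_inv_mul]
  · obtain ⟨i, hi⟩ := hK.exists_subset_subgroup h.exhausts_right (finite_closedBall (1 : Λ) R)
    obtain ⟨S, hS, hd⟩ := exists_dist_le_of_finite _ (hHfin (i + 1))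
    refine ⟨S, hS, fun y y' hyy' => hd _ _ (hprop i _ _ (hi ?_))⟩
    rwa [hg y, hg y', Metric.mem_closedBall, dist_comm, dist_one_inv_mul]
  · exact ⟨1, one_pos, fun y => by simp [hg y]⟩
  · obtain ⟨S, hS, hd⟩ := exists_dist_le_of_finite _ (hHfin 1)
    -- `x` and its image under the section after `f` have the same value under `f`, so properness at
    -- level 0 puts them in one coset of `H 1`.
    refine ⟨S, hS, fun x => hd _ _ (hprop 0 _ _ ?_)⟩
    have : f ((Function.surjInv hsurj ∘ f) x) = f x := hg (f x)
    rw [this, id, inv_mul_cancel]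
    exact (K 0).one_mem

end CoarseClassification

/-! ### Proof of the equivalence. -/

theorem exists_forall_eq_zsmul_of_addEquiv {M N : Type*} [AddCommGroup M] [AddCommGroup N]
    (E : M ≃+ N) (h : ∃ g : M, ∀ x, ∃ k : ℤ, x = k • g) : ∃ g : N, ∀ x, ∃ k : ℤ, x = k • g := by
  obtain ⟨g, hg⟩ := h
  refine ⟨E g, fun x => ?_⟩
  obtain ⟨k, hk⟩ := hg (E.symm x)
  exact ⟨k, by rw [← map_zsmul, ← hk, E.apply_symm_apply]⟩

theorem mainTheorem7 {Γ Λ : Type*}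
    [Group Γ] [Countable Γ] [MetricSpace Γ] [ProperSpace Γ] [IsIsometricSMul Γ Γ]
    [Group Λ] [Countable Λ] [MetricSpace Λ] [ProperSpace Λ] [IsIsometricSMul Λ Λ]
    (hΓ : IsLocallyFiniteGroup Γ) (hΛ : IsLocallyFiniteGroup Λ) :
    List.TFAE [
      CoarselyEquivalent Γ Λ,
      ∀ (p : ℝ≥0∞) [Fact (1 ≤ p)] (hp : p ≠ ⊤),
        Nonempty (KZero (uniformRoeAlgebra Γ p hp) ≃+ KZero (uniformRoeAlgebra Λ p hp)),
      ∃ (p : ℝ≥0∞) (_ : Fact (1 ≤ p)) (hp : p ≠ ⊤),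
        Nonempty (KZero (uniformRoeAlgebra Γ p hp) ≃+ KZero (uniformRoeAlgebra Λ p hp))] := by
  tfae_have 1 → 2 := fun h p _ hp =>
    nonempty_kZero_addEquiv_of_coarselyEquivalent (exists_encard_closedBall_le Γ)
      (exists_encard_closedBall_le Λ) h hp
  tfae_have 2 → 3 := fun h => ⟨1, ⟨le_rfl⟩, ENNReal.one_ne_top, @h 1 ⟨le_rfl⟩ _⟩
  tfae_have 3 → 1 := by
    rintro ⟨p, _, hp, ⟨E⟩⟩
    -- The isomorphism `E` matters only in the two mixed cases, where it would identify a cyclic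
    -- group with a non-cyclic one.
    rcases finite_or_infinite Γ with _ | _ <;> rcases finite_or_infinite Λ with _ | _
    · exact coarselyEquivalent_of_finite Γ Λ
    · exact absurd (exists_forall_eq_zsmul_of_addEquiv E (exists_forall_kZero_eq_zsmul_of_finite Γ hp))
        (not_exists_forall_kZero_eq_zsmul hΛ hp)
    · exact absurd (exists_forall_eq_zsmul_of_addEquiv E.symm (exists_forall_kZero_eq_zsmul_of_finite Λ hp))
        (not_exists_forall_kZero_eq_zsmul hΓ hp)
    · exact coarselyEquivalent_of_infinite hΓ hΛ
  tfae_finish
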